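/- **Setting.** Let $\Gamma=\bigcup_{\gamma\in\mathcal E}\gamma([0,1])\subset\mathbb R^N$ be an embedded network: $\mathcal E$ is a finite nonempty set of regular ($C^1$ on $[0,1]$ with nowhere vanishing derivative) simple curves $\gamma:[0,1]\to\mathbb R^N$, called arcs (only $\gamma(0)=\gamma(1)$ is allowed as a self-intersection; $\gamma$ is then called closed), which contains with each arc $\gamma$ its inverse $\widetilde\gamma(s)=\gamma(1-s)$. The vertex set $\mathbf V$ consists of the endpoints of the arcs. It is assumed that $\gamma((0,1))\cap\gamma'((0,1))=\emptyset$ whenever $\gamma\ne\gamma'$ and $\gamma\neq\widetilde{\gamma'}$, that $\gamma((0,1))\cap\mathbf V=\emptyset$ for every arc $\gamma$, and that any two vertices are linked by a finite concatenation of arcs. Continuity on $\Gamma$ refers to the geodesic distance (infimum of the Euclidean lengths of curves in $\Gamma$). The set $\mathbf E$ of edges is in bijection with $\mathcal E$; the edge $e$ corresponding to $\gamma$ has origin $\mathrm o(e)=\gamma(0)$, terminal vertex $\mathrm t(e)=\gamma(1)$, and $-e$ corresponds to $\widetilde\gamma$. For $x\in\mathbf V$ let $\mathbf E_x=\{e\in\mathbf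 E:\mathrm o(e)=x\}$. Let $H_\gamma:[0,1]\times\mathbb R\to\mathbb R$ $(\gamma\in\mathcal E)$ satisfy $H_{\widetilde\gamma}(s,p)=H_\gamma(1-s,-p)$. Each $H_\gamma$ is continuous and, for every $s$, coercive and quasiconvex in $p$ with $\operatorname{Int}\{p: H_\gamma(s,p)\le b\}=\{p: H_\gamma(s,p)<b\}$ for all $b\in\mathbb R$. Put $$a_\gamma=\max_{s\in[0,1]}\min_{p\in\mathbb R}H_\gamma(s,p),\qquad c_\gamma=\min\{a:\ H_\gamma(s,w')=a\text{ has a viscosity subsolution in }(0,1),\ w\in C([0,1]),\ w(0)=w(1)\},$$ and let $a_0$ be the maximum of the $a_\gamma$ over the non-closed arcs and the $c_\gamma$ over the closed arcs. Assume also that $s\mapsto\min_pH_\gamma(s,p)$ is constant on $[0,1]$ for every arc $\gamma$ with $a_\gamma=a_0$. A function $v:\Gamma\to\mathbb R$ is a *subsolution* of $\mathcal H(x,Dv)=a$ on $\Gamma$ if it is continuous and, for every arc $\gamma$, $v\circ\gamma$ is a viscosity subsolution of $H_\gamma(s,(v\circ\gamma)')=a$ in $(0,1)$. It is a *solution* if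 it is continuous, $v\circ\gamma$ is a viscosity solution of this equation in $(0,1)$ for every arc $\gamma$, and for every vertex $x$ there is an arc $\gamma$ with $\gamma(1)=x$ such that $H_\gamma(1,\varphi'(1))\ge a$ for every $\varphi\in C^1([0,1])$ with $\varphi(1)=v(\gamma(1))$ and $\varphi\le v\circ\gamma$ in $(1-\delta,1)$ for some $\delta>0$. For $a\ge a_0$ and $e\in\mathbf E$ with corresponding arc $\gamma$, let $\sigma_a(e)=\int_0^1\max\{p: H_\gamma(t,p)=a\}\,dt$. A function $u:\mathbf V\to\mathbb R$ is a *solution* (resp. *subsolution*) of the discrete functional equation if, for every $x\in\mathbf V$, $$u(x)=\min_{e\in\mathbf E_x}\big(u(\mathrm t(e))+\sigma_a(-e)\big)\qquad\Big(\text{resp. } u(x)\le\min_{e\in\mathbf E_x}\big(u(\mathrm t(e))+\sigma_a(-e)\big)\Big).$$ **Proposition.** Let $a\ge a_0$. (i) Every solution $u:\mathbf V\to\mathbb R$ of the discrete functional equation extends to a unique solution of $\mathcal H(x,Dv)=a$ on $\Gamma$. Conversely, the restriction to $\mathbf V$ of any solution of $\mathcal H(x,Dv)=a$ on $\Gamma$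 is a solution of the discrete functional equation. (ii) Every subsolution $u:\mathbf V\to\mathbb R$ of the discrete functional equation extends to a subsolution of $\mathcal H(x,Dv)=a$ on $\Gamma$. Conversely, the restriction to $\mathbf V$ of any subsolution of $\mathcal H(x,Dv)=a$ on $\Gamma$ is a subsolution of the discrete functional equation. -/

import Mathlib

open Set Filter

noncomputable section

/-! ### Viscosity notions on the interval `[0,1]` -/

/-- `φ` is a `C¹` function on `[0,1]` touching `w` from above at `s`. -/
def IsSupertangent (w φ : ℝ → ℝ) (s : ℝ) : Prop :=
  ContDiffOn ℝ 1 φ (Icc 0 1) ∧ w s = φ s ∧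
    ∃ δ > 0, ∀ t ∈ Ioo (s - δ) (s + δ) ∩ Icc 0 1, w t ≤ φ t

/-- `φ` is a `C¹` function on `[0,1]` touching `w` from below at `s`, relative to `[0,1]`.
At `s = 0, 1` this is the notion of a constrained subtangent. -/
def IsSubtangent (w φ : ℝ → ℝ) (s : ℝ) : Prop :=
  ContDiffOn ℝ 1 φ (Icc 0 1) ∧ w s = φ s ∧
    ∃ δ > 0, ∀ t ∈ Ioo (s - δ) (s + δ) ∩ Icc 0 1, φ t ≤ w t

/-- `w`, continuous on `[0,1]`, is a viscosity subsolution of `h (s, w') = a` in `(0,1)`. -/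
def IsArcSubsolution (h : ℝ → ℝ → ℝ) (a : ℝ) (w : ℝ → ℝ) : Prop :=
  ContinuousOn w (Icc 0 1) ∧
    ∀ s ∈ Ioo (0 : ℝ) 1, ∀ φ : ℝ → ℝ, IsSupertangent w φ s →
      h s (derivWithin φ (Icc 0 1) s) ≤ a

/-- `w`, continuous on `[0,1]`, is a viscosity solution of `h (s, w') = a` in `(0,1)`. -/
def IsArcSolution (h : ℝ → ℝ → ℝ) (a : ℝ) (w : ℝ → ℝ) : Prop :=
  IsArcSubsolution h a w ∧
    ∀ s ∈ Ioo (0 : ℝ) 1, ∀ φ : ℝ → ℝ, IsSubtangent w φ s →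
      a ≤ h s (derivWithin φ (Icc 0 1) s)

/-- The state constraint boundary condition for `h (s, w') = a` at an endpoint `s₀`. -/
def StateConstraint (h : ℝ → ℝ → ℝ) (a : ℝ) (w : ℝ → ℝ) (s₀ : ℝ) : Prop :=
  ∀ φ : ℝ → ℝ, IsSubtangent w φ s₀ → a ≤ h s₀ (derivWithin φ (Icc 0 1) s₀)

/-- `a_γ = max_s min_p h (s, p)`. -/
def arcA (h : ℝ → ℝ → ℝ) : ℝ := ⨆ s : Icc (0 : ℝ) 1, ⨅ p : ℝ, h s p

/-- `c_γ`: the least `a` for which `h = a` has a subsolution in `(0,1)` with equal values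
at the endpoints. -/
def arcC (h : ℝ → ℝ → ℝ) : ℝ := sInf {a | ∃ w : ℝ → ℝ, IsArcSubsolution h a w ∧ w 0 = w 1}

/-- `σ⁺_a (s) = max {p | h (s, p) = a}`. -/
def sigmaPlus (h : ℝ → ℝ → ℝ) (a s : ℝ) : ℝ := sSup {p | h s p = a}

/-! ### Embedded networks -/

/-- An embedded network in `ℝⁿ`. The index type `E` is the set of edges of the underlying abstract
graph, `arc` is the parametrization of edges by arcs, and `rev` is the reversal of edges. -/
structure EmbeddedNetwork (n : ℕ) (E : Type*) where
  arc : E → ℝ → EuclideanSpace ℝ (Fin n)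
  rev : E → E
  nonempty : Nonempty E
  /-- arcs are regular curves -/
  contDiffOn_arc : ∀ e, ContDiffOn ℝ 1 (arc e) (Icc 0 1)
  derivWithin_arc_ne_zero : ∀ e, ∀ s ∈ Icc (0 : ℝ) 1, derivWithin (arc e) (Icc 0 1) s ≠ 0
  /-- arcs are simple: only the two endpoints may coincide -/
  simple_arc : ∀ e, ∀ s ∈ Icc (0 : ℝ) 1, ∀ t ∈ Icc (0 : ℝ) 1, s < t → arc e s = arc e t →
    s = 0 ∧ t = 1
  /-- the inverse of each arc is the arc of the reversed edge -/
  arc_rev : ∀ e, ∀ s ∈ Icc (0 : ℝ) 1, arc (rev e) s = arc e (1 - s)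
  /-- arcs that are different and not inverse to each other do not meet at interior points -/
  disjoint_arc : ∀ e e', e ≠ e' → e ≠ rev e' →
    Disjoint (arc e '' Ioo 0 1) (arc e' '' Ioo 0 1)
  /-- no vertex is an interior point of an arc -/
  arc_ne_endpoint : ∀ e e', ∀ s ∈ Ioo (0 : ℝ) 1, arc e s ≠ arc e' 0 ∧ arc e s ≠ arc e' 1
  /-- any two endpoints of arcs are linked by a finite concatenation of arcs -/
  connected : ∀ e e', Relation.ReflTransGen
    (fun x y => ∃ f, arc f 0 = x ∧ arc f 1 = y) (arc e 0) (arc e' 0)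

namespace EmbeddedNetwork

variable {n : ℕ} {E : Type*}

/-- The network `Γ` as a subset of `ℝⁿ`. -/
def carrier (N : EmbeddedNetwork n E) : Set (EuclideanSpace ℝ (Fin n)) :=
  ⋃ e, N.arc e '' Icc 0 1

/-- The vertices: initial and terminal points of the arcs. -/
def vertices (N : EmbeddedNetwork n E) : Set (EuclideanSpace ℝ (Fin n)) :=
  {x | ∃ e, x = N.arc e 0 ∨ x = N.arc e 1}

theorem vertices_subset (N : EmbeddedNetwork n E) : N.vertices ⊆ N.carrier := by
  rintro x ⟨e, rfl | rfl⟩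
  · exact mem_iUnion.2 ⟨e, 0, by simp, rfl⟩
  · exact mem_iUnion.2 ⟨e, 1, by simp, rfl⟩

/-- The initial vertex of an edge. -/
def src (N : EmbeddedNetwork n E) (e : E) : N.vertices := ⟨N.arc e 0, e, Or.inl rfl⟩

/-- The terminal vertex of an edge. -/
def tgt (N : EmbeddedNetwork n E) (e : E) : N.vertices := N.src (N.rev e)

theorem coe_tgt (N : EmbeddedNetwork n E) (e : E) :
    (N.tgt e : EuclideanSpace ℝ (Fin n)) = N.arc e 1 := by
  simpa [tgt, src] using N.arc_rev e 0 (by simp)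

/-- Every vertex is the initial point of some arc. -/
theorem exists_src_eq (N : EmbeddedNetwork n E) (x : N.vertices) : ∃ e, N.src e = x := by
  obtain ⟨x, e, rfl | rfl⟩ := x
  · exact ⟨e, rfl⟩
  · exact ⟨N.rev e, Subtype.ext (N.coe_tgt e)⟩

/-- The point of `Γ` with parameter `s ∈ [0,1]` on an arc. -/
def point (N : EmbeddedNetwork n E) (e : E) (s : Icc (0 : ℝ) 1) : N.carrier :=
  ⟨N.arc e s, mem_iUnion.2 ⟨e, s, s.2, rfl⟩⟩

/-- `u ∘ γ` on `[0,1]` (extended by constants outside `[0,1]`, where its values are irrelevant). -/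
def along (N : EmbeddedNetwork n E) (u : N.carrier → ℝ) (e : E) : ℝ → ℝ :=
  IccExtend zero_le_one (fun s => u (N.point e s))

/-- The trace on the vertices of a function on `Γ`. -/
def trace (N : EmbeddedNetwork n E) (u : N.carrier → ℝ) : N.vertices → ℝ :=
  fun x => u ⟨x, N.vertices_subset x.2⟩

/-- The geodesic distance of `Γ`: the infimum of the Euclidean lengths of the curves in `Γ`
joining two points. -/
def geodesicDist (N : EmbeddedNetwork n E) (x y : N.carrier) : ENNReal :=
  sInf {L | ∃ c : ℝ → EuclideanSpace ℝ (Fin n), ContinuousOn c (Icc 0 1) ∧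
    MapsTo c (Icc 0 1) N.carrier ∧ c 0 = x ∧ c 1 = y ∧ L = eVariationOn c (Icc 0 1)}

/-- Continuity on `Γ` with respect to the geodesic distance. -/
def IsContinuous (N : EmbeddedNetwork n E) (u : N.carrier → ℝ) : Prop :=
  ∀ x, ∀ ε > 0, ∃ δ > 0, ∀ y, N.geodesicDist x y < ENNReal.ofReal δ → |u y - u x| < ε

/-! ### Hamiltonians on networks -/

open Classical in
/-- `a_γ` for a non-closed arc and `c_γ` for a closed arc. -/
def arcLevel (N : EmbeddedNetwork n E) (H : E → ℝ → ℝ → ℝ) (e : E) : ℝ :=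
  if N.arc e 0 = N.arc e 1 then arcC (H e) else arcA (H e)

/-- `a₀`: the maximum of the `a_γ` of the non-closed arcs and the `c_γ` of the closed arcs. -/
def a₀ (N : EmbeddedNetwork n E) (H : E → ℝ → ℝ → ℝ) : ℝ := ⨆ e, N.arcLevel H e

/-- `H` is a Hamiltonian on the network. Only the values `H e s p` with `s ∈ [0,1]` matter. -/
structure IsHamiltonian (N : EmbeddedNetwork n E) (H : E → ℝ → ℝ → ℝ) : Prop where
  rev : ∀ e, ∀ s ∈ Icc (0 : ℝ) 1, ∀ p, H (N.rev e) s p = H e (1 - s) (-p)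
  continuousOn : ∀ e, ContinuousOn (fun q : ℝ × ℝ => H e q.1 q.2) (Icc 0 1 ×ˢ univ)
  coercive : ∀ e, ∀ s ∈ Icc (0 : ℝ) 1, Tendsto (H e s) (cocompact ℝ) atTop
  quasiconvex : ∀ e, ∀ s ∈ Icc (0 : ℝ) 1, QuasiconvexOn ℝ univ (H e s)
  interior_sublevel : ∀ e, ∀ s ∈ Icc (0 : ℝ) 1, ∀ b : ℝ,
    interior {p | H e s p ≤ b} = {p | H e s p < b}
  min_const : ∀ e, arcA (H e) = N.a₀ H →
    ∀ s ∈ Icc (0 : ℝ) 1, ∀ t ∈ Icc (0 : ℝ) 1, ⨅ p, H e s p = ⨅ p, H e t p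

/-! ### The Hamilton–Jacobi equation on the network -/

/-- Subsolutions of `H (x, Du) = a` on `Γ`. -/
def IsSubsolution (N : EmbeddedNetwork n E) (H : E → ℝ → ℝ → ℝ) (a : ℝ)
    (u : N.carrier → ℝ) : Prop :=
  N.IsContinuous u ∧ ∀ e, IsArcSubsolution (H e) a (N.along u e)

/-- Solutions of `H (x, Du) = a` on `Γ`. -/
def IsSolution (N : EmbeddedNetwork n E) (H : E → ℝ → ℝ → ℝ) (a : ℝ)
    (u : N.carrier → ℝ) : Prop :=
  N.IsContinuous u ∧ (∀ e, IsArcSolution (H e) a (N.along u e)) ∧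
    ∀ x : N.vertices, ∃ e, N.tgt e = x ∧ StateConstraint (H e) a (N.along u e) 1

/-! ### The discrete functional equation -/

/-- `σ_a (e) = ∫₀¹ σ⁺_a (t) dt`. -/
def sigma (H : E → ℝ → ℝ → ℝ) (a : ℝ) (e : E) : ℝ := ∫ t in (0 : ℝ)..1, sigmaPlus (H e) a t

/-- The values `u (t(e)) + σ_a (-e)`, for the edges `e` issuing from `x`. -/
def starValues (N : EmbeddedNetwork n E) (H : E → ℝ → ℝ → ℝ) (a : ℝ) (u : N.vertices → ℝ)
    (x : N.vertices) : Set ℝ :=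
  (fun e => u (N.tgt e) + sigma H a (N.rev e)) '' {e | N.src e = x}

/-- `min (u (t(e)) + σ_a (-e))` over the edges `e` issuing from `x`. -/
def starMin (N : EmbeddedNetwork n E) (H : E → ℝ → ℝ → ℝ) (a : ℝ) (u : N.vertices → ℝ)
    (x : N.vertices) : ℝ := sInf (N.starValues H a u x)

/-- For a finite network `starMin` is a genuine minimum. -/
theorem isLeast_starMin [Finite E] (N : EmbeddedNetwork n E) (H : E → ℝ → ℝ → ℝ) (a : ℝ)
    (u : N.vertices → ℝ) (x : N.vertices) :
    IsLeast (N.starValues H a u x) (N.starMin H a u x) := by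
  have hf : (N.starValues H a u x).Finite := (Set.toFinite _).image _
  obtain ⟨e, he⟩ := N.exists_src_eq x
  have hne : (N.starValues H a u x).Nonempty := ⟨_, e, he, rfl⟩
  exact ⟨hne.csInf_mem hf, fun _ hy => csInf_le hf.bddBelow hy⟩

/-- Solutions of the discrete functional equation. -/
def IsDiscreteSolution (N : EmbeddedNetwork n E) (H : E → ℝ → ℝ → ℝ) (a : ℝ)
    (u : N.vertices → ℝ) : Prop := ∀ x, u x = N.starMin H a u x

/-- Subsolutions of the discrete functional equation. -/
def IsDiscreteSubsolution (N : EmbeddedNetwork n E) (H : E → ℝ → ℝ → ℝ) (a : ℝ)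
    (u : N.vertices → ℝ) : Prop := ∀ x, u x ≤ N.starMin H a u x

end EmbeddedNetwork

end

/-! ### Touching a continuous function by a monotone test function -/

/-! Fix an edge and `a ≥ a₀`. The sublevel `{p | H e s p ≤ a}` is an interval `[m s, M s]` with ends
continuous in `s`: `M` is `sigmaPlus` of the arc, and `m s` is minus `sigmaPlus` of the reversed arc
at `1 - s` (`IsArcHamiltonian.isSublevelEnds`). A continuous function on the arc is a subsolution
exactly when its increments over `[s, t]` lie between `∫ m` and `∫ M`. Over the whole arc this says
that the increment is at most `sigma H a e`, and its negative at most `sigma H a (N.rev e)`; over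
all edges, this is the discrete subsolution inequality. Conversely, endpoint values obeying it are
interpolated by `arcExtension`, a minimum of two `C¹` functions with slopes `M` and `m`, which is
even a solution. Up to reversal arcs meet only at vertices, so these pieces glue.

For solutions two more facts are needed. A solution with the state constraint at `1` has increment
`∫ M` (`sub_eq_integral_of_stateConstraint`), and `arcExtension` satisfies that constraint when its
increment is `∫ M`; this matches attainment of the discrete minimum. A solution also equals the
`arcExtension` of its own endpoint values (`eqOn_arcExtension`), whence uniqueness. Both rest on
comparison: a `C¹` function with slope strictly between `m` and `M` cannot touch a solution from
below. This needs `m < M` throughout. Otherwise `a = arcA (H e) = a₀`, the minimum over `p` is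
constant along the arc, and `m = M` prescribes all increments. -/

theorem exists_isMaxOn_sub_of_lt {g : ℝ → ℝ} {s t : ℝ} (hst : s < t)
    (hg : ContinuousOn g (Icc s t)) (h : g s < g t) :
    ∃ x ∈ Ioo s t, ∃ ψ : ℝ → ℝ, ContDiff ℝ 1 ψ ∧ 0 < deriv ψ x ∧
      IsMaxOn (fun y => g y - ψ y) (Icc s t) x := by
  have hd : 0 < t - s := sub_pos.2 hst
  obtain ⟨r, hr, hgr⟩ : ∃ r ∈ Ioo s t, g s < g r := by
    have h1 : ∀ᶠ y in nhdsWithin t (Icc s t), g s < g y :=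
      (hg t (right_mem_Icc.2 hst.le)).eventually (lt_mem_nhds h)
    have h2 : ∀ᶠ y in nhdsWithin t (Ioo s t), g s < g y :=
      h1.filter_mono (nhdsWithin_mono _ Ioo_subset_Icc_self)
    have : (nhdsWithin t (Ioo s t)).NeBot := right_nhdsWithin_Ioo_neBot hst
    obtain ⟨y, hy, hy'⟩ := (h2.and self_mem_nhdsWithin).exists
    exact ⟨y, hy', hy⟩
  -- The height `C` puts `g - ψ` at `t` below its value at `s`, while a high power keeps `ψ r` under
  -- `g r - g s`, so the maximum is interior. The exponent `n + 1` ensures `ψ s = 0` even for `n =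
  -- 0`.
  set C := g t - g s + 1 with hC
  have hCpos : 0 < C := by linarith
  obtain ⟨n, hn⟩ : ∃ n : ℕ, ((r - s) / (t - s)) ^ n < (g r - g s) / C :=
    exists_pow_lt_of_lt_one (div_pos (by linarith) hCpos)
      ((div_lt_one hd).2 (by linarith [hr.2]))
  have hθ0 : 0 ≤ (r - s) / (t - s) := div_nonneg (by linarith [hr.1]) hd.le
  have hθ1 : (r - s) / (t - s) ≤ 1 := (div_le_one hd).2 (by linarith [hr.2])
  have hn1 : C * ((r - s) / (t - s)) ^ (n + 1) < g r - g s := by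
    have : ((r - s) / (t - s)) ^ (n + 1) < (g r - g s) / C :=
      (pow_le_pow_of_le_one hθ0 hθ1 n.le_succ).trans_lt hn
    rw [lt_div_iff₀ hCpos] at this
    linarith
  set ψ : ℝ → ℝ := fun y => C * ((y - s) / (t - s)) ^ (n + 1) with hψ
  have hψc : ContDiff ℝ 1 ψ := by rw [hψ]; fun_prop
  have hk : ContinuousOn (fun y => g y - ψ y) (Icc s t) := hg.sub hψc.continuous.continuousOn
  obtain ⟨x, hx, hmax⟩ := isCompact_Icc.exists_isMaxOn (nonempty_Icc.2 hst.le) hk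
  have hxr : g r - ψ r ≤ g x - ψ x := hmax (Ioo_subset_Icc_self hr)
  have hψs : ψ s = 0 := by simp [hψ]
  have hψt : ψ t = C := by simp [hψ, div_self hd.ne']
  have hψr : ψ r < g r - g s := hn1
  have hxs : x ≠ s := by rintro rfl; linarith
  have hxt : x ≠ t := by rintro rfl; linarith
  have hx' : x ∈ Ioo s t := ⟨lt_of_le_of_ne hx.1 hxs.symm, lt_of_le_of_ne hx.2 hxt⟩
  refine ⟨x, hx', ψ, hψc, ?_, hmax⟩
  have hder : HasDerivAt ψ (C * ((n + 1 : ℕ) * ((x - s) / (t - s)) ^ n * (1 / (t - s)))) x := by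
    have := ((((hasDerivAt_id x).sub_const s).div_const (t - s)).pow (n + 1)).const_mul C
    simpa [hψ] using this
  rw [hder.deriv]
  have : 0 < (x - s) / (t - s) := div_pos (by linarith [hx'.1]) hd
  positivity

theorem exists_isMaxOn_sub_of_gt {g : ℝ → ℝ} {s t : ℝ} (hst : s < t)
    (hg : ContinuousOn g (Icc s t)) (h : g t < g s) :
    ∃ x ∈ Ioo s t, ∃ ψ : ℝ → ℝ, ContDiff ℝ 1 ψ ∧ deriv ψ x < 0 ∧
      IsMaxOn (fun y => g y - ψ y) (Icc s t) x := by
  obtain ⟨x, hx, ψ, hψ, hd, hmax⟩ := exists_isMaxOn_sub_of_lt (g := fun y => g (-y))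
    (neg_lt_neg hst) (hg.comp continuous_neg.continuousOn fun y hy => by
      simp only [mem_Icc] at hy ⊢; constructor <;> linarith [hy.1, hy.2]) (by simpa using h)
  refine ⟨-x, ⟨by linarith [hx.2], by linarith [hx.1]⟩, fun y => ψ (-y), hψ.comp contDiff_neg,
    ?_, fun y hy => ?_⟩
  · rw [deriv_comp_neg]; simpa using hd
  · have := hmax (a := -y) ⟨by linarith [hy.2], by linarith [hy.1]⟩
    simpa using this

theorem exists_isMinOn_sub_of_lt {g : ℝ → ℝ} {s t : ℝ} (hst : s < t)
    (hg : ContinuousOn g (Icc s t)) (h : g s < g t) :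
    ∃ x ∈ Ioo s t, ∃ ψ : ℝ → ℝ, ContDiff ℝ 1 ψ ∧ 0 < deriv ψ x ∧
      IsMinOn (fun y => g y - ψ y) (Icc s t) x := by
  obtain ⟨x, hx, ψ, hψ, hd, hmax⟩ := exists_isMaxOn_sub_of_gt hst hg.neg (neg_lt_neg h)
  refine ⟨x, hx, -ψ, hψ.neg, by rw [deriv.neg]; linarith, fun y hy => ?_⟩
  have := hmax hy
  simp only [mem_ofPred_eq, Pi.neg_apply] at this ⊢
  linarith

theorem exists_isMinOn_sub_of_gt {g : ℝ → ℝ} {s t : ℝ} (hst : s < t)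
    (hg : ContinuousOn g (Icc s t)) (h : g t < g s) :
    ∃ x ∈ Ioo s t, ∃ ψ : ℝ → ℝ, ContDiff ℝ 1 ψ ∧ deriv ψ x < 0 ∧
      IsMinOn (fun y => g y - ψ y) (Icc s t) x := by
  obtain ⟨x, hx, ψ, hψ, hd, hmax⟩ := exists_isMaxOn_sub_of_lt hst hg.neg (neg_lt_neg h)
  refine ⟨x, hx, -ψ, hψ.neg, by rw [deriv.neg]; linarith, fun y hy => ?_⟩
  have := hmax hy
  simp only [mem_ofPred_eq, Pi.neg_apply] at this ⊢
  linarith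

/-! ### One-sided consequences of the sign of a derivative on `[0,1]` -/

theorem eventually_left_lt_of_derivWithin_pos {k : ℝ → ℝ} {c s : ℝ}
    (hk : HasDerivWithinAt k c (Icc 0 1) s) (h0 : 0 < s) (h1 : s ≤ 1) (hc : 0 < c) :
    ∀ᶠ y in nhdsWithin s (Iio s), k y < k s := by
  have h2 : HasDerivWithinAt k c (Ioo 0 s) s :=
    hk.mono fun y hy => ⟨hy.1.le, hy.2.le.trans h1⟩
  rw [hasDerivWithinAt_iff_tendsto_slope' (by simp), nhdsWithin_Ioo_eq_nhdsLT h0] at h2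
  filter_upwards [h2.eventually (lt_mem_nhds hc), self_mem_nhdsWithin] with y hy hys
  rw [slope_def_field, div_pos_iff] at hy
  have : y < s := hys
  rcases hy with hy | hy <;> linarith [hy.1, hy.2]

theorem eventually_right_lt_of_derivWithin_neg {k : ℝ → ℝ} {c s : ℝ}
    (hk : HasDerivWithinAt k c (Icc 0 1) s) (h0 : 0 ≤ s) (h1 : s < 1) (hc : c < 0) :
    ∀ᶠ y in nhdsWithin s (Ioi s), k y < k s := by
  have h2 : HasDerivWithinAt k c (Ioo s 1) s :=
    hk.mono fun y hy => ⟨h0.trans hy.1.le, hy.2.le⟩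
  rw [hasDerivWithinAt_iff_tendsto_slope' (by simp), nhdsWithin_Ioo_eq_nhdsGT h1] at h2
  filter_upwards [h2.eventually (gt_mem_nhds hc), self_mem_nhdsWithin] with y hy hys
  rw [slope_def_field, div_neg_iff] at hy
  have : s < y := hys
  rcases hy with hy | hy <;> linarith [hy.1, hy.2]

theorem eventually_left_gt_of_derivWithin_neg {k : ℝ → ℝ} {c s : ℝ}
    (hk : HasDerivWithinAt k c (Icc 0 1) s) (h0 : 0 < s) (h1 : s ≤ 1) (hc : c < 0) :
    ∀ᶠ y in nhdsWithin s (Iio s), k s < k y := by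
  filter_upwards [eventually_left_lt_of_derivWithin_pos hk.neg h0 h1 (neg_pos.2 hc)] with y hy
  simpa using hy

theorem eventually_right_gt_of_derivWithin_pos {k : ℝ → ℝ} {c s : ℝ}
    (hk : HasDerivWithinAt k c (Icc 0 1) s) (h0 : 0 ≤ s) (h1 : s < 1) (hc : 0 < c) :
    ∀ᶠ y in nhdsWithin s (Ioi s), k s < k y := by
  filter_upwards [eventually_right_lt_of_derivWithin_neg hk.neg h0 h1 (neg_neg_iff_pos.2 hc)]
    with y hy
  simpa using hy

/-! ### Primitives of continuous functions -/

theorem hasDerivAt_primitive {f : ℝ → ℝ} (hf : Continuous f) (x : ℝ) :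
    HasDerivAt (fun y => ∫ r in (0 : ℝ)..y, f r) (f x) x :=
  intervalIntegral.integral_hasDerivAt_right (hf.intervalIntegrable _ _)
    (hf.stronglyMeasurableAtFilter _ _) hf.continuousAt

theorem contDiff_primitive {f : ℝ → ℝ} (hf : Continuous f) :
    ContDiff ℝ 1 (fun y => ∫ r in (0 : ℝ)..y, f r) := by
  rw [contDiff_one_iff_deriv]
  refine ⟨fun x => (hasDerivAt_primitive hf x).differentiableAt, ?_⟩
  rwa [funext fun x => (hasDerivAt_primitive hf x).deriv]

theorem primitive_sub {f : ℝ → ℝ} (hf : Continuous f) (s t : ℝ) :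
    (∫ r in (0 : ℝ)..t, f r) - ∫ r in (0 : ℝ)..s, f r = ∫ r in s..t, f r :=
  intervalIntegral.integral_interval_sub_left (hf.intervalIntegrable _ _)
    (hf.intervalIntegrable _ _)

/-! ### Test functions defined by global extrema -/

theorem derivWithin_Icc_add_const {φ : ℝ → ℝ} (hφ : ContDiff ℝ 1 φ) {x : ℝ}
    (hx : x ∈ Icc (0 : ℝ) 1) (c : ℝ) :
    derivWithin (fun y => φ y + c) (Icc 0 1) x = deriv φ x :=
  ((hφ.differentiable one_ne_zero x).hasDerivAt.add_const c).hasDerivWithinAt.derivWithin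
    (uniqueDiffOn_Icc_zero_one x hx)

theorem IsArcSubsolution.apply_le {h : ℝ → ℝ → ℝ} {a : ℝ} {w : ℝ → ℝ}
    (hw : IsArcSubsolution h a w) {φ : ℝ → ℝ} (hφ : ContDiff ℝ 1 φ) {s t x : ℝ} (hs : 0 ≤ s)
    (ht : t ≤ 1) (hx : x ∈ Ioo s t) (hmax : IsMaxOn (fun y => w y - φ y) (Icc s t) x) :
    h x (deriv φ x) ≤ a := by
  have hx01 : x ∈ Ioo (0 : ℝ) 1 := ⟨hs.trans_lt hx.1, hx.2.trans_le ht⟩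
  rw [← derivWithin_Icc_add_const hφ (Ioo_subset_Icc_self hx01) (w x - φ x)]
  refine hw.2 x hx01 _ ⟨by fun_prop, by ring, min (x - s) (t - x),
    lt_min (by linarith [hx.1]) (by linarith [hx.2]), fun y hy => ?_⟩
  have h1 := min_le_left (x - s) (t - x)
  have h2 := min_le_right (x - s) (t - x)
  have := hmax (a := y) ⟨by linarith [hy.1.1], by linarith [hy.1.2]⟩
  simp only [mem_ofPred_eq] at this
  linarith

/-- The supersolution test is assumed at the single point `x`, so that the same argument serves
interior points and, through the second alternative in `hxt`, the state constraint at `1`. -/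
theorem le_apply_of_isMinOn {h : ℝ → ℝ → ℝ} {a : ℝ} {w φ : ℝ → ℝ} {s t x : ℝ}
    (hw : ∀ φ : ℝ → ℝ, IsSubtangent w φ x → a ≤ h x (derivWithin φ (Icc 0 1) x))
    (hφ : ContDiff ℝ 1 φ) (hx : x ∈ Icc (0 : ℝ) 1) (hsx : s < x) (hxt : x < t ∨ t = 1 ∧ x = 1)
    (hmin : IsMinOn (fun y => w y - φ y) (Icc s t) x) : a ≤ h x (deriv φ x) := by
  rw [← derivWithin_Icc_add_const hφ hx (w x - φ x)]
  obtain ⟨ε, hε, hεt⟩ : ∃ ε > 0, ∀ y < x + ε, y ≤ 1 → y ≤ t := by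
    rcases hxt with hxt | ⟨rfl, rfl⟩
    · exact ⟨t - x, by linarith, fun y hy _ => by linarith⟩
    · exact ⟨1, one_pos, fun y _ hy => hy⟩
  refine hw _ ⟨by fun_prop, by ring, min (x - s) ε, lt_min (by linarith) hε, fun y hy => ?_⟩
  have h1 := min_le_left (x - s) ε
  have h2 := min_le_right (x - s) ε
  have := hmin (a := y) ⟨by linarith [hy.1.1], hεt y (by linarith [hy.1.2]) hy.2.2⟩
  simp only [mem_ofPred_eq] at this
  linarith

theorem IsArcSolution.le_apply {h : ℝ → ℝ → ℝ} {a : ℝ} {w : ℝ → ℝ}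
    (hw : IsArcSolution h a w) {φ : ℝ → ℝ} (hφ : ContDiff ℝ 1 φ) {s t x : ℝ} (hs : 0 ≤ s)
    (ht : t ≤ 1) (hx : x ∈ Ioo s t) (hmin : IsMinOn (fun y => w y - φ y) (Icc s t) x) :
    a ≤ h x (deriv φ x) :=
  have hx01 : x ∈ Ioo (0 : ℝ) 1 := ⟨hs.trans_lt hx.1, hx.2.trans_le ht⟩
  le_apply_of_isMinOn (hw.2 x hx01) hφ (Ioo_subset_Icc_self hx01) hx.1 (Or.inl hx.2) hmin

/-! ### The equation on an arc -/

/-- For `s ∈ [0,1]` the sublevel `{p | h s p ≤ a}` is the interval `[m s, M s]` and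
`{p | h s p < a}` is its interior; the endpoints depend continuously on `s`, and the intervals
are either all nondegenerate or all degenerate. -/
structure IsSublevelEnds (h : ℝ → ℝ → ℝ) (a : ℝ) (m M : ℝ → ℝ) : Prop where
  continuous_lower : Continuous m
  continuous_upper : Continuous M
  le_iff : ∀ s ∈ Icc (0 : ℝ) 1, ∀ p, h s p ≤ a ↔ m s ≤ p ∧ p ≤ M s
  ge_iff : ∀ s ∈ Icc (0 : ℝ) 1, ∀ p, a ≤ h s p ↔ p ≤ m s ∨ M s ≤ p
  lower_le_upper : ∀ s ∈ Icc (0 : ℝ) 1, m s ≤ M s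
  lt_or_eq : (∀ s ∈ Icc (0 : ℝ) 1, m s < M s) ∨ ∀ s ∈ Icc (0 : ℝ) 1, m s = M s

namespace IsSublevelEnds

variable {h : ℝ → ℝ → ℝ} {a : ℝ} {m M w : ℝ → ℝ}

/-- If `w` outgrew the primitive of `M`, some test function would touch it from above with slope
larger than `M x`, outside the sublevel. -/
theorem sub_le_integral (hE : IsSublevelEnds h a m M) (hw : IsArcSubsolution h a w) {s t : ℝ}
    (hs : 0 ≤ s) (hst : s ≤ t) (ht : t ≤ 1) : w t - w s ≤ ∫ r in s..t, M r := by
  have hM := hE.continuous_upper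
  by_contra! hlt
  rcases hst.eq_or_lt with rfl | hst
  · simp at hlt
  rw [← primitive_sub hM] at hlt
  obtain ⟨x, hx, ψ, hψ, hd, hmax⟩ := exists_isMaxOn_sub_of_lt
    (g := fun y => w y - ∫ r in (0 : ℝ)..y, M r) hst
    ((hw.1.mono (Icc_subset_Icc hs ht)).sub (contDiff_primitive hM).continuous.continuousOn)
    (by linarith)
  have hx01 : x ∈ Icc (0 : ℝ) 1 := ⟨hs.trans hx.1.le, hx.2.le.trans ht⟩
  have hle := hw.apply_le ((contDiff_primitive hM).add hψ) hs ht hx (by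
    refine hmax.congr (fun y hy => ?_) ?_ <;> simp [sub_sub])
  have hder : deriv (fun y => (∫ r in (0 : ℝ)..y, M r) + ψ y) x = M x + deriv ψ x :=
    ((hasDerivAt_primitive hM x).add (hψ.differentiable one_ne_zero x).hasDerivAt).deriv
  rw [hder, hE.le_iff x hx01] at hle
  linarith [hle.2]

theorem integral_le_sub (hE : IsSublevelEnds h a m M) (hw : IsArcSubsolution h a w) {s t : ℝ}
    (hs : 0 ≤ s) (hst : s ≤ t) (ht : t ≤ 1) : ∫ r in s..t, m r ≤ w t - w s := by
  have hm := hE.continuous_lower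
  by_contra! hlt
  rcases hst.eq_or_lt with rfl | hst
  · simp at hlt
  rw [← primitive_sub hm] at hlt
  obtain ⟨x, hx, ψ, hψ, hd, hmax⟩ := exists_isMaxOn_sub_of_gt
    (g := fun y => w y - ∫ r in (0 : ℝ)..y, m r) hst
    ((hw.1.mono (Icc_subset_Icc hs ht)).sub (contDiff_primitive hm).continuous.continuousOn)
    (by linarith)
  have hx01 : x ∈ Icc (0 : ℝ) 1 := ⟨hs.trans hx.1.le, hx.2.le.trans ht⟩
  have hle := hw.apply_le ((contDiff_primitive hm).add hψ) hs ht hx (by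
    refine hmax.congr (fun y hy => ?_) ?_ <;> simp [sub_sub])
  have hder : deriv (fun y => (∫ r in (0 : ℝ)..y, m r) + ψ y) x = m x + deriv ψ x :=
    ((hasDerivAt_primitive hm x).add (hψ.differentiable one_ne_zero x).hasDerivAt).deriv
  rw [hder, hE.le_iff x hx01] at hle
  linarith [hle.1]

/-- Slope bounds between `m` and `M` characterize subsolutions on an arc. -/
theorem isArcSubsolution_of_bounds (hE : IsSublevelEnds h a m M)
    (hc : ContinuousOn w (Icc 0 1))
    (hm : ∀ s t, 0 ≤ s → s ≤ t → t ≤ 1 → ∫ r in s..t, m r ≤ w t - w s)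
    (hM : ∀ s t, 0 ≤ s → s ≤ t → t ≤ 1 → w t - w s ≤ ∫ r in s..t, M r) :
    IsArcSubsolution h a w := by
  refine ⟨hc, fun s hs φ ⟨hφ, hφs, δ, hδ, hle⟩ => ?_⟩
  have hs' := Ioo_subset_Icc_self hs
  have hd := (hφ.differentiableOn one_ne_zero s hs').hasDerivWithinAt
  rw [hE.le_iff s hs']
  constructor
  · by_contra! hlt
    -- A supertangent with slope below `m s` falls, just to the right of `s`, under the lower bound
    -- for `w`. For a slope above `M s` the contradiction appears on the left.
    have hk := hd.sub (hasDerivAt_primitive hE.continuous_lower s).hasDerivWithinAt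
    have hev := eventually_right_lt_of_derivWithin_neg hk hs.1.le hs.2 (sub_neg.2 hlt)
    obtain ⟨y, hy, hys⟩ := (hev.and (Ioo_mem_nhdsGT
      (show s < min 1 (s + δ) from lt_min hs.2 (by linarith)))).exists
    have h1 := min_le_left 1 (s + δ)
    have h2 := min_le_right 1 (s + δ)
    have h3 := hle y ⟨⟨by linarith [hys.1], by linarith [hys.2]⟩, by linarith [hys.1, hs.1],
      by linarith [hys.2]⟩
    have h4 := hm s y hs.1.le hys.1.le (by linarith [hys.2])
    rw [← primitive_sub hE.continuous_lower] at h4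
    simp only [Pi.sub_apply] at hy
    linarith
  · by_contra! hlt
    have hk := hd.sub (hasDerivAt_primitive hE.continuous_upper s).hasDerivWithinAt
    have hev := eventually_left_lt_of_derivWithin_pos hk hs.1 hs.2.le (sub_pos.2 hlt)
    obtain ⟨y, hy, hys⟩ := (hev.and (Ioo_mem_nhdsLT
      (show max 0 (s - δ) < s from max_lt hs.1 (by linarith)))).exists
    have h1 := le_max_left 0 (s - δ)
    have h2 := le_max_right 0 (s - δ)
    have h3 := hle y ⟨⟨by linarith [hys.1], by linarith [hys.2]⟩, by linarith [hys.1],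
      by linarith [hys.2, hs.2]⟩
    have h4 := hM y s (by linarith [hys.1]) hys.2.le hs.2.le
    rw [← primitive_sub hE.continuous_upper] at h4
    simp only [Pi.sub_apply] at hy
    linarith

theorem integral_lower_le_upper (hE : IsSublevelEnds h a m M) {s t : ℝ} (hs : 0 ≤ s)
    (hst : s ≤ t) (ht : t ≤ 1) : ∫ r in s..t, m r ≤ ∫ r in s..t, M r :=
  intervalIntegral.integral_mono_on hst (hE.continuous_lower.intervalIntegrable _ _)
    (hE.continuous_upper.intervalIntegrable _ _)
    fun r hr => hE.lower_le_upper r ⟨hs.trans hr.1, hr.2.trans ht⟩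

end IsSublevelEnds

/-- The largest function on `[0,1]` that is bounded by `α` at `0`, by `β` at `1`, and whose slopes
lie between `m` and `M`. -/
noncomputable def arcExtension (m M : ℝ → ℝ) (α β s : ℝ) : ℝ :=
  min (α + ∫ r in (0 : ℝ)..s, M r) (β - ∫ r in s..1, m r)

/-! ### Solutions on an arc with prescribed endpoint values -/

namespace IsSublevelEnds

variable {h : ℝ → ℝ → ℝ} {a : ℝ} {m M w : ℝ → ℝ} {α β : ℝ}

theorem arcExtension_zero (h0 : ∫ r in (0 : ℝ)..1, m r ≤ β - α) :
    arcExtension m M α β 0 = α := by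
  simp only [arcExtension, intervalIntegral.integral_same, add_zero]
  exact min_eq_left (by linarith)

theorem arcExtension_one (h1 : β - α ≤ ∫ r in (0 : ℝ)..1, M r) :
    arcExtension m M α β 1 = β := by
  simp only [arcExtension, intervalIntegral.integral_same, sub_zero]
  exact min_eq_right (by linarith)

theorem hasDerivAt_sub_integral (hE : IsSublevelEnds h a m M) (s : ℝ) :
    HasDerivAt (fun y => β - ∫ r in y..1, m r) (m s) s := by
  have := (hasDerivAt_primitive hE.continuous_lower s).const_add
    (β - ∫ r in (0 : ℝ)..1, m r)
  refine this.congr_of_eventuallyEq (Eventually.of_forall fun y => ?_)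
  simp only [← primitive_sub hE.continuous_lower y 1]
  ring

theorem continuous_arcExtension (hE : IsSublevelEnds h a m M) :
    Continuous (arcExtension m M α β) := by
  refine (continuous_const.add (contDiff_primitive hE.continuous_upper).continuous).min ?_
  exact continuous_iff_continuousAt.2 fun s => (hE.hasDerivAt_sub_integral s).continuousAt

/-- A minimum inherits the increment bounds shared by its two branches. A subtangent at `s` also
lies below the smooth branch attaining the minimum there, hence has the same derivative, `M s` or `m
s`, an end of the sublevel. -/
theorem isArcSolution_arcExtension (hE : IsSublevelEnds h a m M) :
    IsArcSolution h a (arcExtension m M α β) := by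
  refine ⟨hE.isArcSubsolution_of_bounds hE.continuous_arcExtension.continuousOn ?_ ?_, ?_⟩
  · intro s t hs hst ht
    have h1 := hE.integral_lower_le_upper hs hst ht
    have h2 := primitive_sub hE.continuous_upper s t
    have h3 := primitive_sub hE.continuous_lower s t
    have h4 := primitive_sub hE.continuous_lower s 1
    have h5 := primitive_sub hE.continuous_lower t 1
    rw [le_sub_iff_add_le]
    refine le_min ?_ ?_
    · have := min_le_left (α + ∫ r in (0 : ℝ)..s, M r) (β - ∫ r in s..1, m r)
      unfold arcExtension; linarith
    · have := min_le_right (α + ∫ r in (0 : ℝ)..s, M r) (β - ∫ r in s..1, m r)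
      unfold arcExtension; linarith
  · intro s t hs hst ht
    have h1 := hE.integral_lower_le_upper hs hst ht
    have h2 := primitive_sub hE.continuous_upper s t
    have h3 := primitive_sub hE.continuous_lower s t
    have h4 := primitive_sub hE.continuous_lower s 1
    have h5 := primitive_sub hE.continuous_lower t 1
    rw [sub_le_iff_le_add', ← sub_le_iff_le_add]
    refine le_min ?_ ?_
    · have := min_le_left (α + ∫ r in (0 : ℝ)..t, M r) (β - ∫ r in t..1, m r)
      unfold arcExtension; linarith
    · have := min_le_right (α + ∫ r in (0 : ℝ)..t, M r) (β - ∫ r in t..1, m r)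
      unfold arcExtension; linarith
  · intro s hs φ ⟨hφ, hφs, δ, hδ, hle⟩
    have hs' := Ioo_subset_Icc_self hs
    have hd : HasDerivAt φ (derivWithin φ (Icc 0 1) s) s :=
      (hφ.differentiableOn one_ne_zero s hs').hasDerivWithinAt.hasDerivAt
        (Icc_mem_nhds hs.1 hs.2)
    have hnear : ∀ᶠ y in nhds s, φ y ≤ arcExtension m M α β y := by
      filter_upwards [Ioo_mem_nhds (sub_lt_self s hδ) (lt_add_of_pos_right s hδ),
        Icc_mem_nhds hs.1 hs.2] with y hy hy' using hle y ⟨hy, hy'⟩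
    have key : ∀ f c, HasDerivAt f c s → (∀ y, arcExtension m M α β y ≤ f y) →
        arcExtension m M α β s = f s → derivWithin φ (Icc 0 1) s = c := by
      intro f c hf hup hfs
      have hloc : IsLocalMax (φ - f) s := by
        filter_upwards [hnear] with y hy
        have := hup y
        simp only [Pi.sub_apply]
        linarith
      have := hloc.hasDerivAt_eq_zero (hd.sub hf)
      linarith
    rw [hE.ge_iff s hs']
    rcases min_choice (α + ∫ r in (0 : ℝ)..s, M r) (β - ∫ r in s..1, m r) with h1 | h1
    · exact Or.inr (key _ _ ((hasDerivAt_primitive hE.continuous_upper s).const_add α)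
        (fun y => min_le_left _ _) h1).ge
    · exact Or.inl (key _ _ (hE.hasDerivAt_sub_integral s) (fun y => min_le_right _ _) h1).le

/-- The extension satisfies the state constraint at `1` if the terminal datum is the largest
possible one. -/
theorem stateConstraint_arcExtension (hE : IsSublevelEnds h a m M)
    (hβ : β = α + ∫ r in (0 : ℝ)..1, M r) (hwc : EqOn w (arcExtension m M α β) (Icc 0 1)) :
    StateConstraint h a w 1 := by
  -- With the largest terminal value the first branch attains the minimum on the whole arc.
  have hw : ∀ s ∈ Icc (0 : ℝ) 1, w s = α + ∫ r in (0 : ℝ)..s, M r := by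
    intro s hs
    have h1 := hE.integral_lower_le_upper hs.1 hs.2 le_rfl
    have h2 := primitive_sub hE.continuous_upper s 1
    rw [hwc hs]
    exact min_eq_left (by linarith)
  rintro φ ⟨hφ, hφs, δ, hδ, hle⟩
  have h1m : (1 : ℝ) ∈ Icc (0 : ℝ) 1 := by simp
  have hd := (hφ.differentiableOn one_ne_zero 1 h1m).hasDerivWithinAt
  rw [hE.ge_iff 1 h1m]
  right
  by_contra! hlt
  have hk := hd.sub (hasDerivAt_primitive hE.continuous_upper 1).hasDerivWithinAt
  have hev := eventually_left_gt_of_derivWithin_neg hk one_pos le_rfl (sub_neg.2 hlt)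
  obtain ⟨y, hy, hys⟩ := (hev.and (Ioo_mem_nhdsLT
    (show max 0 (1 - δ) < 1 from max_lt one_pos (by linarith)))).exists
  have h1 := le_max_left 0 (1 - δ)
  have h2 := le_max_right 0 (1 - δ)
  have hy01 : y ∈ Icc (0 : ℝ) 1 := ⟨by linarith [hys.1], hys.2.le⟩
  have h3 := hle y ⟨⟨by linarith [hys.1], by linarith [hys.2]⟩, hy01⟩
  rw [hw y hy01] at h3
  rw [hw 1 h1m] at hφs
  simp only [Pi.sub_apply] at hy
  linarith

/-! ### Comparison with strict subsolutions -/

theorem hasDerivAt_convex_primitive (hE : IsSublevelEnds h a m M) (θ x : ℝ) :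
    HasDerivAt (fun y => ∫ r in (0 : ℝ)..y, (M r - θ * (M r - m r)))
      (M x - θ * (M x - m x)) x :=
  hasDerivAt_primitive (f := fun r => M r - θ * (M r - m r)) (by
    have := hE.continuous_lower; have := hE.continuous_upper; fun_prop) x

theorem contDiff_convex_primitive (hE : IsSublevelEnds h a m M) (θ : ℝ) :
    ContDiff ℝ 1 (fun y => ∫ r in (0 : ℝ)..y, (M r - θ * (M r - m r))) :=
  contDiff_primitive (f := fun r => M r - θ * (M r - m r)) (by
    have := hE.continuous_lower; have := hE.continuous_upper; fun_prop)

/-- The slope is a strict convex combination of `m x` and `M x`, so it lies where `h x` is less than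
`a`. Such a primitive therefore fails the supersolution test. -/
theorem not_le_apply_deriv_convex_primitive (hE : IsSublevelEnds h a m M) {θ x : ℝ}
    (hθ : θ ∈ Ioo (0 : ℝ) 1) (hx : x ∈ Icc (0 : ℝ) 1) (hlt : m x < M x) :
    ¬ a ≤ h x (deriv (fun y => ∫ r in (0 : ℝ)..y, (M r - θ * (M r - m r))) x) := by
  rw [(hE.hasDerivAt_convex_primitive θ x).deriv, hE.ge_iff x hx]
  have h1 : 0 < M x - m x := sub_pos.2 hlt
  have h2 := mul_pos hθ.1 h1
  have h3 := mul_pos (sub_pos.2 hθ.2) h1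
  rintro (h4 | h4) <;> linarith

/-- A solution satisfying the state constraint at `1` has the largest possible increment. -/
theorem sub_eq_integral_of_stateConstraint (hE : IsSublevelEnds h a m M)
    (hw : IsArcSolution h a w) (hsc : StateConstraint h a w 1) :
    w 1 - w 0 = ∫ r in (0 : ℝ)..1, M r := by
  have hup := hE.sub_le_integral hw.1 le_rfl zero_le_one le_rfl
  rcases hE.lt_or_eq with hlt | heq
  swap
  · refine le_antisymm hup ?_
    have hlow := hE.integral_le_sub hw.1 le_rfl zero_le_one le_rfl
    rwa [intervalIntegral.integral_congr (g := M) fun r hr => heq r (by simpa using hr)] at hlow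
  by_contra hne
  have hgap := sub_pos.2 (lt_of_le_of_ne hup hne)
  set I := ∫ r in (0 : ℝ)..1, (M r - m r) with hI
  -- For small `θ` the primitive `B` still climbs more than `w` does over `[0,1]`, so `w - B` is
  -- smaller at `1` than at `0` and its minimum is not at `0`.
  obtain ⟨θ, hθ, hθI⟩ : ∃ θ ∈ Ioo (0 : ℝ) 1, θ * I < (∫ r in (0 : ℝ)..1, M r) - (w 1 - w 0) := by
    have h1 : Tendsto (fun θ : ℝ => θ * I) (nhdsWithin 0 (Ioi 0)) (nhds 0) := by
      have : Tendsto (fun θ : ℝ => θ * I) (nhds 0) (nhds (0 * I)) :=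
        (continuous_id.mul continuous_const).tendsto 0
      rw [zero_mul] at this
      exact this.mono_left nhdsWithin_le_nhds
    obtain ⟨θ, h2, h3⟩ := ((h1.eventually (gt_mem_nhds hgap)).and
      (Ioo_mem_nhdsGT (one_pos (α := ℝ)))).exists
    exact ⟨θ, h3, h2⟩
  set B : ℝ → ℝ := fun y => ∫ r in (0 : ℝ)..y, (M r - θ * (M r - m r)) with hB
  have hBc : ContDiff ℝ 1 B := hE.contDiff_convex_primitive θ
  have hB1 : B 1 = (∫ r in (0 : ℝ)..1, M r) - θ * I := by
    have hm := hE.continuous_lower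
    have hM := hE.continuous_upper
    rw [hB, hI, ← intervalIntegral.integral_const_mul]
    exact intervalIntegral.integral_sub (hM.intervalIntegrable _ _)
      ((continuous_const.mul (hM.sub hm)).intervalIntegrable _ _)
  have hB0 : B 0 = 0 := by simp [hB]
  obtain ⟨x, hx, hmin⟩ := isCompact_Icc.exists_isMinOn (nonempty_Icc.2 zero_le_one)
    (hw.1.1.sub hBc.continuous.continuousOn)
  have hx0 : x ≠ 0 := by
    rintro rfl
    have := hmin (a := 1) (by simp)
    simp only [mem_ofPred_eq, Pi.sub_apply] at this
    linarith
  have hxpos : 0 < x := lt_of_le_of_ne hx.1 hx0.symm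
  refine hE.not_le_apply_deriv_convex_primitive hθ hx (hlt x hx) ?_
  -- A minimum at `1` is excluded by the state constraint, an interior one by the equation.
  rcases hx.2.eq_or_lt with rfl | hx1
  · exact le_apply_of_isMinOn hsc hBc hx hxpos (Or.inr ⟨rfl, rfl⟩) hmin
  · exact hw.le_apply hBc le_rfl le_rfl ⟨hxpos, hx1⟩ hmin

/-- A solution on an arc is determined by its values at the endpoints. -/
theorem eqOn_arcExtension (hE : IsSublevelEnds h a m M) (hw : IsArcSolution h a w) :
    EqOn w (arcExtension m M (w 0) (w 1)) (Icc 0 1) := by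
  intro s hs
  have hm := hE.continuous_lower
  have hM := hE.continuous_upper
  have h1 := hE.sub_le_integral hw.1 le_rfl hs.1 hs.2
  have h2 := hE.integral_le_sub hw.1 hs.1 hs.2 le_rfl
  refine le_antisymm (le_min (by linarith) (by linarith)) ?_
  by_contra! hlt'
  obtain ⟨hl1, hl2⟩ := lt_min_iff.1 hlt'
  rcases hE.lt_or_eq with hlt | heq
  swap
  · have hlow := hE.integral_le_sub hw.1 le_rfl hs.1 hs.2
    rw [intervalIntegral.integral_congr (g := M) fun r hr => heq r (by
      rw [uIcc_of_le hs.1] at hr; exact ⟨hr.1, hr.2.trans hs.2⟩)] at hlow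
    linarith
  have hs0 : 0 < s := by
    refine lt_of_le_of_ne hs.1 ?_
    rintro rfl
    simp at hl1
  have hs1 : s < 1 := by
    refine lt_of_le_of_ne hs.2 ?_
    rintro rfl
    simp at hl2
  have hcont := hw.1.1
  -- `B` has the midpoint slope. If `w` lies below both branches at `s`, then `w - B` decreases
  -- somewhere to the left of `s` and increases somewhere to the right. It then has an interior
  -- minimum between, where `B` is a forbidden test function.
  set B : ℝ → ℝ := fun y => ∫ r in (0 : ℝ)..y, (M r - (1 / 2) * (M r - m r)) with hB
  have hBc : ContDiff ℝ 1 B := hE.contDiff_convex_primitive _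
  obtain ⟨x, hx, l, hl, hlx⟩ : ∃ x ∈ Ioo 0 s, ∃ l ∈ Ioo 0 x, w x - B x < w l - B l := by
    obtain ⟨x, hx, ψ, hψ, hd, hmin⟩ := exists_isMinOn_sub_of_gt
      (g := fun y => w y - ∫ r in (0 : ℝ)..y, M r) hs0
      ((hcont.mono (Icc_subset_Icc le_rfl hs.2)).sub
        (contDiff_primitive hM).continuous.continuousOn) (by simp; linarith)
    have hx01 : x ∈ Ioo (0 : ℝ) 1 := ⟨hx.1, hx.2.trans hs1⟩
    have hφ := (contDiff_primitive hM).add hψ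
    have hmin' : IsMinOn (fun y => w y - ((∫ r in (0 : ℝ)..y, M r) + ψ y)) (Icc 0 s) x := by
      refine hmin.congr (fun y hy => ?_) ?_ <;> simp [sub_sub]
    have hle := hw.le_apply hφ le_rfl hs.2 hx hmin'
    have hder : HasDerivAt (fun y => (∫ r in (0 : ℝ)..y, M r) + ψ y) (M x + deriv ψ x) x :=
      (hasDerivAt_primitive hM x).add (hψ.differentiable one_ne_zero x).hasDerivAt
    rw [hder.deriv, hE.ge_iff x (Ioo_subset_Icc_self hx01)] at hle
    -- The supersolution test forbids slopes strictly between `m x` and `M x`; a slope below `M x`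
    -- must therefore drop to `m x` or less, below that of `B`.
    have hslope : M x + deriv ψ x ≤ m x := hle.resolve_right (by linarith)
    have hx' := hlt x (Ioo_subset_Icc_self hx01)
    have hk := (hder.sub (hE.hasDerivAt_convex_primitive (1 / 2) x)).hasDerivWithinAt (s := Icc 0 1)
    obtain ⟨l, hl, hlx⟩ := ((eventually_left_gt_of_derivWithin_neg hk hx01.1 hx01.2.le
      (by linarith)).and (Ioo_mem_nhdsLT hx.1)).exists
    refine ⟨x, hx, l, hlx, ?_⟩
    have := hmin' (a := l) ⟨hlx.1.le, hlx.2.le.trans hx.2.le⟩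
    simp only [mem_ofPred_eq, Pi.sub_apply] at this hl
    simp only [hB]
    linarith
  obtain ⟨y, hy, r, hr, hry⟩ : ∃ y ∈ Ioo s 1, ∃ r ∈ Ioo y 1, w y - B y < w r - B r := by
    obtain ⟨x, hx, ψ, hψ, hd, hmin⟩ := exists_isMinOn_sub_of_lt
      (g := fun y => w y - ∫ r in (0 : ℝ)..y, m r) hs1
      ((hcont.mono (Icc_subset_Icc hs.1 le_rfl)).sub
        (contDiff_primitive hm).continuous.continuousOn)
      (by have := primitive_sub hm s 1; linarith)
    have hx01 : x ∈ Ioo (0 : ℝ) 1 := ⟨hs0.trans hx.1, hx.2⟩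
    have hφ := (contDiff_primitive hm).add hψ
    have hmin' : IsMinOn (fun y => w y - ((∫ r in (0 : ℝ)..y, m r) + ψ y)) (Icc s 1) x := by
      refine hmin.congr (fun y hy => ?_) ?_ <;> simp [sub_sub]
    have hle := hw.le_apply hφ hs.1 le_rfl hx hmin'
    have hder : HasDerivAt (fun y => (∫ r in (0 : ℝ)..y, m r) + ψ y) (m x + deriv ψ x) x :=
      (hasDerivAt_primitive hm x).add (hψ.differentiable one_ne_zero x).hasDerivAt
    rw [hder.deriv, hE.ge_iff x (Ioo_subset_Icc_self hx01)] at hle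
    have hslope : M x ≤ m x + deriv ψ x := hle.resolve_left (by linarith)
    have hx' := hlt x (Ioo_subset_Icc_self hx01)
    have hk := (hder.sub (hE.hasDerivAt_convex_primitive (1 / 2) x)).hasDerivWithinAt (s := Icc 0 1)
    obtain ⟨r, hr, hrx⟩ := ((eventually_right_gt_of_derivWithin_pos hk hx01.1.le hx01.2
      (by linarith)).and (Ioo_mem_nhdsGT hx.2)).exists
    refine ⟨x, hx, r, hrx, ?_⟩
    have := hmin' (a := r) ⟨hx.1.le.trans hrx.1.le, hrx.2.le⟩
    simp only [mem_ofPred_eq, Pi.sub_apply] at this hr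
    simp only [hB]
    linarith
  have hxy : x < y := hx.2.trans hy.1
  obtain ⟨z, hz, hmin⟩ := isCompact_Icc.exists_isMinOn
    (nonempty_Icc.2 ((hl.2.trans hxy).trans hr.1).le)
    ((hcont.mono (Icc_subset_Icc hl.1.le hr.2.le)).sub hBc.continuous.continuousOn)
  have hzl : z ≠ l := by
    rintro rfl
    have := hmin (a := x) ⟨hl.2.le, (hxy.trans hr.1).le⟩
    simp only [mem_ofPred_eq, Pi.sub_apply] at this
    linarith
  have hzr : z ≠ r := by
    rintro rfl
    have := hmin (a := y) ⟨(hl.2.trans hxy).le, hr.1.le⟩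
    simp only [mem_ofPred_eq, Pi.sub_apply] at this
    linarith
  have hz' : z ∈ Ioo l r := ⟨lt_of_le_of_ne hz.1 hzl.symm, lt_of_le_of_ne hz.2 hzr⟩
  have hz01 : z ∈ Icc (0 : ℝ) 1 := ⟨hl.1.le.trans hz.1, hz.2.trans hr.2.le⟩
  exact hE.not_le_apply_deriv_convex_primitive (by norm_num) hz01 (hlt z hz01)
    (hw.le_apply hBc hl.1.le hr.2.le hz' hmin)

end IsSublevelEnds

/-! ### Sublevels of a coercive quasiconvex Hamiltonian -/

/-- The assumptions on the Hamiltonian `h (s, p)` of one arc. -/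
structure IsArcHamiltonian (h : ℝ → ℝ → ℝ) : Prop where
  continuousOn : ContinuousOn (fun q : ℝ × ℝ => h q.1 q.2) (Icc 0 1 ×ˢ univ)
  coercive : ∀ s ∈ Icc (0 : ℝ) 1, Tendsto (h s) (cocompact ℝ) atTop
  quasiconvex : ∀ s ∈ Icc (0 : ℝ) 1, QuasiconvexOn ℝ univ (h s)
  interior_sublevel : ∀ s ∈ Icc (0 : ℝ) 1, ∀ b : ℝ,
    interior {p | h s p ≤ b} = {p | h s p < b}

namespace IsArcHamiltonian

variable {h : ℝ → ℝ → ℝ} {a : ℝ}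

theorem continuous_apply (hh : IsArcHamiltonian h) {s : ℝ} (hs : s ∈ Icc (0 : ℝ) 1) :
    Continuous (h s) :=
  continuousOn_univ.1 (hh.continuousOn.comp (f := fun p : ℝ => (s, p)) (by fun_prop)
    fun _ _ => ⟨hs, mem_univ _⟩)

theorem continuousOn_apply (hh : IsArcHamiltonian h) (p : ℝ) :
    ContinuousOn (fun s => h s p) (Icc 0 1) :=
  hh.continuousOn.comp (f := fun s : ℝ => (s, p)) (by fun_prop) fun _ hs => ⟨hs, mem_univ _⟩

theorem exists_forall_le (hh : IsArcHamiltonian h) {s : ℝ} (hs : s ∈ Icc (0 : ℝ) 1) :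
    ∃ p, ∀ q, h s p ≤ h s q :=
  (hh.continuous_apply hs).exists_forall_le (hh.coercive s hs)

theorem iInf_eq {s p : ℝ} (hp : ∀ q, h s p ≤ h s q) : ⨅ q, h s q = h s p :=
  le_antisymm (ciInf_le ⟨h s p, by rintro _ ⟨q, rfl⟩; exact hp q⟩ p) (le_ciInf hp)

/-- Between `p` and `r` the values of `h s` do not exceed the larger one at `p` and `r`. -/
theorem le_max (hh : IsArcHamiltonian h) {s : ℝ} (hs : s ∈ Icc (0 : ℝ) 1) {p q r : ℝ}
    (hpq : p ≤ q) (hqr : q ≤ r) : h s q ≤ max (h s p) (h s r) := by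
  have hc := (hh.quasiconvex s hs (max (h s p) (h s r))).ordConnected
  exact (hc.out (x := p) ⟨mem_univ _, le_max_left _ _⟩ (y := r) ⟨mem_univ _, le_max_right _ _⟩
    ⟨hpq, hqr⟩).2

/-- Coercivity and quasiconvexity make the sublevel a compact interval. The interior condition rules
out flat parts at level `a`, so the level set is exactly the pair of ends. -/
theorem exists_sublevel_eq (hh : IsArcHamiltonian h) {s : ℝ} (hs : s ∈ Icc (0 : ℝ) 1)
    (hne : ∃ p, h s p ≤ a) : ∃ l r, l ≤ r ∧ {p | h s p ≤ a} = Icc l r ∧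
      {p | h s p < a} = Ioo l r ∧ {p | h s p = a} = {l, r} := by
  have hclosed : IsClosed {p | h s p ≤ a} := isClosed_le (hh.continuous_apply hs) continuous_const
  have hcomp : IsCompact {p | h s p ≤ a} := by
    obtain ⟨K, hK, hKa⟩ := mem_cocompact.1 ((hh.coercive s hs).eventually_gt_atTop a)
    refine hK.of_isClosed_subset hclosed fun p hp => ?_
    by_contra hpK
    exact (show h s p ≤ a from hp).not_gt (hKa hpK)
  have hconv : Convex ℝ {p | h s p ≤ a} := by
    simpa using hh.quasiconvex s hs a
  have hconn : IsConnected {p | h s p ≤ a} := ⟨hne, hconv.isPreconnected⟩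
  have hIcc := eq_Icc_of_connected_compact hconn hcomp
  set l := sInf {p | h s p ≤ a}
  set r := sSup {p | h s p ≤ a}
  have hlr : l ≤ r := nonempty_Icc.1 (hIcc ▸ hne)
  have hIoo : {p | h s p < a} = Ioo l r := by
    rw [← hh.interior_sublevel s hs a, hIcc, interior_Icc]
  refine ⟨l, r, hlr, hIcc, hIoo, ?_⟩
  rw [← Icc_sdiff_Ioo_same hlr, ← hIcc, ← hIoo]
  ext p
  simp only [Set.mem_sdiff, mem_ofPred_eq, not_lt]
  exact ⟨fun h => ⟨h.le, h.ge⟩, fun h => le_antisymm h.1 h.2⟩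

theorem iInf_le_of_arcA_le (hh : IsArcHamiltonian h) (ha : arcA h ≤ a) {s : ℝ}
    (hs : s ∈ Icc (0 : ℝ) 1) : ⨅ p, h s p ≤ a := by
  refine le_trans ?_ ha
  obtain ⟨b, hb⟩ := (isCompact_Icc.image_of_continuousOn (hh.continuousOn_apply 0)).bddAbove
  refine le_ciSup (f := fun s : Icc (0 : ℝ) 1 => ⨅ p, h s p) ⟨b, ?_⟩ ⟨s, hs⟩
  rintro _ ⟨t, rfl⟩
  obtain ⟨p, hp⟩ := hh.exists_forall_le t.2
  exact (iInf_eq hp).le.trans ((hp 0).trans (hb ⟨t, t.2, rfl⟩))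

/-- The set of `s` at which all values of `h s` exceed `a` is open in `[0,1]`. -/
theorem eventually_forall_lt (hh : IsArcHamiltonian h) {s : ℝ} (hs : s ∈ Icc (0 : ℝ) 1)
    (hlt : ∀ p, a < h s p) : ∀ᶠ t in nhdsWithin s (Icc 0 1), ∀ p, a < h t p := by
  obtain ⟨K, hK, hKa⟩ := mem_cocompact.1 ((hh.coercive s hs).eventually_gt_atTop (h s 0))
  obtain ⟨R, hR⟩ := hK.isBounded.subset_closedBall (0 : ℝ)
  set L := max R 0 + 1 with hL
  have hout : ∀ p, L ≤ |p| → h s 0 < h s p := by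
    intro p hp
    refine hKa fun hpK => ?_
    have := hR hpK
    rw [mem_closedBall_zero_iff, Real.norm_eq_abs] at this
    linarith [le_max_left R 0]
  have hLpos : 0 < L := by have := le_max_right R 0; linarith
  have h1 := hout L (le_abs_self L)
  have h2 := hout (-L) (by rw [abs_neg]; exact le_abs_self L)
  obtain ⟨c, hc0, hc⟩ := exists_between (lt_min h1 h2)
  -- Coercivity is given only for each `s` separately. The value `c` separates `h t 0` from `h t L`
  -- and `h t (-L)` for `t` near `s`; by quasiconvexity `h t` then stays above `c` outside `[-L,
  -- L]`, and compactness handles the inside.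
  have hcL := hc.trans_le (min_le_left _ _)
  have hcL' := hc.trans_le (min_le_right _ _)
  have hin : ∀ᶠ t in nhdsWithin s (Icc 0 1), ∀ p ∈ Icc (-L) L, a < h t p := by
    have := (isCompact_Icc (a := -L) (b := L)).mem_prod_nhdsSet_of_forall
      (l := nhdsWithin s (Icc 0 1)) (s := {q : ℝ × ℝ | a < h q.1 q.2}) fun p _ => by
        have := hh.continuousOn (s, p) ⟨hs, mem_univ _⟩
        rw [ContinuousWithinAt, nhdsWithin_prod_eq, nhdsWithin_univ] at this
        exact this.eventually (lt_mem_nhds (hlt p))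
    obtain ⟨u, hu, v, hv, huv⟩ := mem_prod_iff.1 this
    filter_upwards [hu] with t ht p hp
    exact huv (show (t, p) ∈ u ×ˢ v from ⟨ht, subset_of_mem_nhdsSet hv hp⟩)
  filter_upwards [hin, self_mem_nhdsWithin,
    (hh.continuousOn_apply 0 s hs).eventually (gt_mem_nhds hc0),
    (hh.continuousOn_apply L s hs).eventually (lt_mem_nhds hcL),
    (hh.continuousOn_apply (-L) s hs).eventually (lt_mem_nhds hcL')] with t ht ht01 h3 h4 h5 p
  by_cases hp : p ∈ Icc (-L) L
  · exact ht p hp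
  have ha0 : a < h t 0 := ht 0 ⟨by linarith, hLpos.le⟩
  rw [mem_Icc, not_and_or, not_le, not_le] at hp
  rcases hp with hp | hp
  · have := hh.le_max ht01 hp.le (neg_nonpos.2 hLpos.le)
    rcases le_max_iff.1 this with h6 | h6 <;> linarith
  · have := hh.le_max ht01 hLpos.le hp.le
    rcases le_max_iff.1 this with h6 | h6 <;> linarith

/-- A subsolution in `(0,1)` exists only for `a ≥ arcA h`. -/
theorem arcA_le_of_isArcSubsolution (hh : IsArcHamiltonian h) {w : ℝ → ℝ}
    (hw : IsArcSubsolution h a w) : arcA h ≤ a := by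
  refine ciSup_le fun ⟨s, hs⟩ => ?_
  obtain ⟨p, hp⟩ := hh.exists_forall_le hs
  change ⨅ q, h s q ≤ a
  rw [iInf_eq hp]
  by_contra! hlt
  obtain ⟨U, hU, hsU, hUa⟩ := mem_nhdsWithin.1
    (hh.eventually_forall_lt hs fun q => hlt.trans_le (hp q))
  have hcl : s ∈ closure (Ioo (0 : ℝ) 1) := by rwa [closure_Ioo zero_ne_one]
  obtain ⟨x, hxU, hx⟩ := mem_closure_iff.1 hcl U hU hsU
  obtain ⟨l, r, hxlr, hlr⟩ := mem_nhds_iff_exists_Ioo_subset.1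
    ((hU.inter isOpen_Ioo).mem_nhds ⟨hxU, hx⟩)
  obtain ⟨l', hl', hl'x⟩ := exists_between hxlr.1
  have hl'01 := hlr ⟨hl', hl'x.trans hxlr.2⟩
  -- This tilt makes `w y + k * y` rise by exactly `x - l'` from `l'` to `x`. Hence some test
  -- function touches `w` from above where every value of `h` exceeds `a`.
  set k := (w l' - w x) / (x - l') + 1 with hk
  have hd : 0 < x - l' := sub_pos.2 hl'x
  obtain ⟨y, hy, ψ, hψ, -, hmax⟩ := exists_isMaxOn_sub_of_lt (g := fun y => w y + k * y) hl'x
    ((hw.1.mono (Icc_subset_Icc hl'01.2.1.le hx.2.le)).add (by fun_prop)) (by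
      have : k * (x - l') = w l' - w x + (x - l') := by rw [hk]; field_simp
      linarith)
  have h1 := hw.apply_le (φ := fun y => ψ y - k * y) (by fun_prop) hl'01.2.1.le hx.2.le hy (by
    convert hmax using 2 with z; ring)
  have hyU : y ∈ U ∩ Icc 0 1 :=
    have := hlr ⟨hl'.trans hy.1, hy.2.trans hxlr.2⟩
    ⟨this.1, Ioo_subset_Icc_self this.2⟩
  exact absurd h1 (not_le.2 (hUa hyU _))

theorem arcA_le_arcC (hh : IsArcHamiltonian h) : arcA h ≤ arcC h := by
  refine le_csInf ?_ fun b ⟨w, hw, _⟩ => hh.arcA_le_of_isArcSubsolution hw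
  -- The infimum defining `arcC` must run over a nonempty set: constants are subsolutions at any
  -- level bounding `h s 0`.
  obtain ⟨b, hb⟩ := (isCompact_Icc.image_of_continuousOn (hh.continuousOn_apply 0)).bddAbove
  refine ⟨b, fun _ => 0, ⟨continuousOn_const, fun s hs φ ⟨hφ, hφs, δ, hδ, hle⟩ => ?_⟩, rfl⟩
  have hs' := Ioo_subset_Icc_self hs
  have hmin : IsLocalMin φ s := by
    filter_upwards [Ioo_mem_nhds (sub_lt_self s hδ) (lt_add_of_pos_right s hδ),
      Icc_mem_nhds hs.1 hs.2] with y hy hy'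
    rw [← hφs]
    exact hle y ⟨hy, hy'⟩
  rw [derivWithin_of_mem_nhds (Icc_mem_nhds hs.1 hs.2), hmin.deriv_eq_zero]
  exact hb ⟨s, hs', rfl⟩

/-- If strict sublevels are nonempty, a point just inside the upper end and one just outside keep
their sides for nearby `t`. If `a` is the minimum for every `s`, the minimizer is unique and
quasiconvexity keeps nearby minimizers close. -/
theorem continuousOn_sigmaPlus (hh : IsArcHamiltonian h)
    (hne : ∀ s ∈ Icc (0 : ℝ) 1, ∃ p, h s p ≤ a)
    (hd : (∀ s ∈ Icc (0 : ℝ) 1, ∃ p, h s p < a) ∨ ∀ s ∈ Icc (0 : ℝ) 1, ∀ p, a ≤ h s p) :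
    ContinuousOn (sigmaPlus h a) (Icc 0 1) := by
  have key : ∀ s ∈ Icc (0 : ℝ) 1, ∃ l, (∀ p, h s p ≤ a ↔ l ≤ p ∧ p ≤ sigmaPlus h a s) ∧
      ∀ p, h s p < a ↔ l < p ∧ p < sigmaPlus h a s := by
    intro s hs
    obtain ⟨l, r, hlr, hIcc, hIoo, heq⟩ := hh.exists_sublevel_eq hs (hne s hs)
    have hr : sigmaPlus h a s = r := by rw [sigmaPlus, heq, csSup_pair, max_eq_right hlr]
    exact hr ▸ ⟨l, fun q => Set.ext_iff.1 hIcc q, fun q => Set.ext_iff.1 hIoo q⟩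
  intro s hs
  obtain ⟨l, hle, hlt⟩ := key s hs
  rw [ContinuousWithinAt, Metric.tendsto_nhds]
  intro ε hε
  rcases hd with hd | hd
  · obtain ⟨p, hp⟩ := hd s hs
    have hp' := (hlt p).1 hp
    obtain ⟨q, hq, hqr⟩ := exists_between
      (max_lt (hp'.1.trans hp'.2) (sub_lt_self (sigmaPlus h a s) hε))
    have hql := (max_lt_iff.1 hq).1
    have hqε := (max_lt_iff.1 hq).2
    have hsq : h s q < a := (hlt q).2 ⟨hql, hqr⟩
    have hsr : a < h s (sigmaPlus h a s + ε) :=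
      not_le.1 fun hc => by linarith [((hle _).1 hc).2]
    filter_upwards [(hh.continuousOn_apply q s hs).eventually (gt_mem_nhds hsq),
      (hh.continuousOn_apply _ s hs).eventually (lt_mem_nhds hsr), self_mem_nhdsWithin]
      with t h1 h2 ht
    obtain ⟨l', hle', hlt'⟩ := key t ht
    have h3 := (hlt' q).1 h1
    have h4 : sigmaPlus h a t < sigmaPlus h a s + ε := by
      by_contra! hc
      exact absurd ((hle' _).2 ⟨by linarith, hc⟩) (not_le.2 h2)
    rw [Real.dist_eq, abs_lt]
    constructor <;> linarith
  · have huniq : ∀ p, h s p ≤ a → p = sigmaPlus h a s := by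
      intro p hp
      by_contra hne'
      have h1 := (hle p).1 hp
      have h2 : p < sigmaPlus h a s := lt_of_le_of_ne h1.2 hne'
      obtain ⟨q, hq, hqr⟩ := exists_between h2
      exact absurd ((hlt q).2 ⟨h1.1.trans_lt hq, hqr⟩) (not_lt.2 (hd s hs q))
    have hval : ∀ t ∈ Icc (0 : ℝ) 1, h t (sigmaPlus h a t) ≤ a := by
      intro t ht
      obtain ⟨l', hle', -⟩ := key t ht
      obtain ⟨p, hp⟩ := hne t ht
      have := (hle' p).1 hp
      exact (hle' _).2 ⟨this.1.trans this.2, le_rfl⟩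
    have h1 : a < h s (sigmaPlus h a s + ε) :=
      not_le.1 fun hc => by linarith [huniq _ hc]
    have h2 : a < h s (sigmaPlus h a s - ε) :=
      not_le.1 fun hc => by linarith [huniq _ hc]
    -- For `t` near `s`, `h t` is below `c` at the old minimizer and above `c` at distance `ε` on
    -- both sides; a minimizer for `t` beyond that distance would violate quasiconvexity.
    obtain ⟨c, hac, hc⟩ := exists_between (lt_min h1 h2)
    filter_upwards [self_mem_nhdsWithin,
      (hh.continuousOn_apply _ s hs).eventually (gt_mem_nhds ((hval s hs).trans_lt hac)),
      (hh.continuousOn_apply _ s hs).eventually (lt_mem_nhds (hc.trans_le (min_le_left _ _))),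
      (hh.continuousOn_apply _ s hs).eventually (lt_mem_nhds (hc.trans_le (min_le_right _ _)))]
      with t ht h3 h4 h5
    have h6 := hval t ht
    rw [Real.dist_eq, abs_lt]
    constructor
    · by_contra! hcon
      have := hh.le_max ht (p := sigmaPlus h a t) (q := sigmaPlus h a s - ε)
        (r := sigmaPlus h a s) (by linarith) (by linarith)
      rcases le_max_iff.1 this with h7 | h7 <;> linarith
    · by_contra! hcon
      have := hh.le_max ht (p := sigmaPlus h a s) (q := sigmaPlus h a s + ε)
        (r := sigmaPlus h a t) (by linarith) (by linarith)
      rcases le_max_iff.1 this with h7 | h7 <;> linarith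

end IsArcHamiltonian

/-- `sigmaPlus h a` on `[0,1]`, extended by constants. -/
noncomputable def sigmaUpper (h : ℝ → ℝ → ℝ) (a : ℝ) : ℝ → ℝ :=
  IccExtend zero_le_one fun s : Icc (0 : ℝ) 1 => sigmaPlus h a s

theorem sigmaUpper_of_mem (h : ℝ → ℝ → ℝ) (a : ℝ) {s : ℝ} (hs : s ∈ Icc (0 : ℝ) 1) :
    sigmaUpper h a s = sigmaPlus h a s :=
  IccExtend_of_mem _ _ hs

namespace IsArcHamiltonian

variable {h h' : ℝ → ℝ → ℝ} {a : ℝ}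

theorem continuous_sigmaUpper (hh : IsArcHamiltonian h)
    (hne : ∀ s ∈ Icc (0 : ℝ) 1, ∃ p, h s p ≤ a)
    (hd : (∀ s ∈ Icc (0 : ℝ) 1, ∃ p, h s p < a) ∨ ∀ s ∈ Icc (0 : ℝ) 1, ∀ p, a ≤ h s p) :
    Continuous (sigmaUpper h a) :=
  (continuousOn_iff_continuous_domRestrict.1 (hh.continuousOn_sigmaPlus hne hd)).Icc_extend'

/-- The ends of the sublevels are given by `sigmaPlus` of `h` and of the reversed
Hamiltonian `h'`. -/
theorem isSublevelEnds (hh : IsArcHamiltonian h) (hh' : IsArcHamiltonian h')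
    (hrev : ∀ s ∈ Icc (0 : ℝ) 1, ∀ p, h' s p = h (1 - s) (-p)) (ha : arcA h ≤ a)
    (hmin : arcA h = a → ∀ s ∈ Icc (0 : ℝ) 1, ∀ t ∈ Icc (0 : ℝ) 1, ⨅ p, h s p = ⨅ p, h t p) :
    IsSublevelEnds h a (fun s => -sigmaUpper h' a (1 - s)) (sigmaUpper h a) := by
  have hsymm : ∀ s ∈ Icc (0 : ℝ) 1, 1 - s ∈ Icc (0 : ℝ) 1 :=
    fun s hs => ⟨by linarith [hs.2], by linarith [hs.1]⟩
  have hne : ∀ s ∈ Icc (0 : ℝ) 1, ∃ p, h s p ≤ a := by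
    intro s hs
    obtain ⟨p, hp⟩ := hh.exists_forall_le hs
    exact ⟨p, (iInf_eq hp).ge.trans (hh.iInf_le_of_arcA_le ha hs)⟩
  have hd : (∀ s ∈ Icc (0 : ℝ) 1, ∃ p, h s p < a) ∨ ∀ s ∈ Icc (0 : ℝ) 1, ∀ p, a ≤ h s p := by
    rcases ha.lt_or_eq with hlt | heq
    · left
      intro s hs
      obtain ⟨p, hp⟩ := hh.exists_forall_le hs
      exact ⟨p, ((iInf_eq hp).ge.trans (hh.iInf_le_of_arcA_le le_rfl hs)).trans_lt hlt⟩
    -- At `a = arcA h` the constant minimum equals its supremum `a`, so no value on the arc is below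
    -- `a`.
    · right
      intro s hs p
      obtain ⟨q, hq⟩ := hh.exists_forall_le hs
      refine le_trans ?_ (hq p)
      rw [← heq, ← iInf_eq hq]
      exact ciSup_le fun t => (hmin heq t t.2 s hs).le
  have hne' : ∀ s ∈ Icc (0 : ℝ) 1, ∃ p, h' s p ≤ a := by
    intro s hs
    obtain ⟨p, hp⟩ := hne _ (hsymm s hs)
    exact ⟨-p, by rwa [hrev s hs, neg_neg]⟩
  have hd' : (∀ s ∈ Icc (0 : ℝ) 1, ∃ p, h' s p < a) ∨ ∀ s ∈ Icc (0 : ℝ) 1, ∀ p, a ≤ h' s p := by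
    refine hd.imp (fun hd s hs => ?_) fun hd s hs p => ?_
    · obtain ⟨p, hp⟩ := hd _ (hsymm s hs)
      exact ⟨-p, by rwa [hrev s hs, neg_neg]⟩
    · rw [hrev s hs]
      exact hd _ (hsymm s hs) _
  have key : ∀ s ∈ Icc (0 : ℝ) 1, -sigmaUpper h' a (1 - s) ≤ sigmaUpper h a s ∧
      (∀ p, h s p ≤ a ↔ -sigmaUpper h' a (1 - s) ≤ p ∧ p ≤ sigmaUpper h a s) ∧
      ∀ p, h s p < a ↔ -sigmaUpper h' a (1 - s) < p ∧ p < sigmaUpper h a s := by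
    intro s hs
    obtain ⟨l, r, hlr, hIcc, hIoo, heq⟩ := hh.exists_sublevel_eq hs (hne s hs)
    have hr : sigmaUpper h a s = r := by
      rw [sigmaUpper_of_mem h a hs, sigmaPlus, heq, csSup_pair, max_eq_right hlr]
    have hl : -sigmaUpper h' a (1 - s) = l := by
      have : {p | h' (1 - s) p = a} = {-l, -r} := by
        ext p
        have := Set.ext_iff.1 heq (-p)
        simp only [mem_ofPred_eq, mem_insert_iff, mem_singleton_iff] at this ⊢
        rw [hrev _ (hsymm s hs), sub_sub_cancel, this, neg_eq_iff_eq_neg, neg_eq_iff_eq_neg]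
      rw [sigmaUpper_of_mem h' a (hsymm s hs), sigmaPlus, this, csSup_pair,
        max_eq_left (neg_le_neg hlr), neg_neg]
    rw [hr, hl]
    exact ⟨hlr, fun q => Set.ext_iff.1 hIcc q, fun q => Set.ext_iff.1 hIoo q⟩
  refine ⟨((hh'.continuous_sigmaUpper hne' hd').comp (by fun_prop)).neg,
    hh.continuous_sigmaUpper hne hd, fun s hs => (key s hs).2.1, fun s hs p => ?_,
    fun s hs => (key s hs).1, hd.imp (fun hd s hs => ?_) fun hd s hs => ?_⟩
  · rw [← not_lt, (key s hs).2.2 p, not_and_or, not_lt, not_lt]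
  · obtain ⟨p, hp⟩ := hd s hs
    have := ((key s hs).2.2 p).1 hp
    exact this.1.trans this.2
  · refine le_antisymm (key s hs).1 ?_
    by_contra! hlt
    obtain ⟨q, hq⟩ := exists_between hlt
    exact absurd (((key s hs).2.2 q).2 hq) (not_lt.2 (hd s hs q))

end IsArcHamiltonian

/-- In this form, reversing the arc just exchanges the two branches, which gives the compatibility
needed for gluing. -/
theorem arcExtension_reflect (f g : ℝ → ℝ) (α β s : ℝ) :
    arcExtension (fun r => -f (1 - r)) g α β s =
      min (α + ∫ r in (0 : ℝ)..s, g r) (β + ∫ r in (0 : ℝ)..(1 - s), f r) := by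
  simp [arcExtension, intervalIntegral.integral_comp_sub_left]

/-- Being a solution on an arc depends only on the values on `[0,1]`. -/
theorem IsArcSolution.congr {h : ℝ → ℝ → ℝ} {a : ℝ} {w w' : ℝ → ℝ} (hw : IsArcSolution h a w)
    (heq : EqOn w' w (Icc 0 1)) : IsArcSolution h a w' := by
  refine ⟨⟨hw.1.1.congr heq, fun s hs φ ⟨hφ, hφs, δ, hδ, hle⟩ => ?_⟩,
    fun s hs φ ⟨hφ, hφs, δ, hδ, hle⟩ => ?_⟩
  · refine hw.1.2 s hs φ ⟨hφ, ?_, δ, hδ, fun t ht => ?_⟩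
    · rw [← heq (Ioo_subset_Icc_self hs), hφs]
    · rw [← heq ht.2]; exact hle t ht
  · refine hw.2 s hs φ ⟨hφ, ?_, δ, hδ, fun t ht => ?_⟩
    · rw [← heq (Ioo_subset_Icc_self hs), hφs]
    · rw [← heq ht.2]; exact hle t ht

namespace EmbeddedNetwork

variable {n : ℕ} {E : Type*}

/-! ### Points and edges of a network -/

theorem arc_injOn_Ioo (N : EmbeddedNetwork n E) (e : E) {s t : ℝ} (hs : s ∈ Ioo (0 : ℝ) 1)
    (ht : t ∈ Ioo (0 : ℝ) 1) (h : N.arc e s = N.arc e t) : s = t := by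
  have hs' := Ioo_subset_Icc_self hs
  have ht' := Ioo_subset_Icc_self ht
  rcases lt_trichotomy s t with hlt | heq | hlt
  · exact absurd (N.simple_arc e s hs' t ht' hlt h).1 hs.1.ne'
  · exact heq
  · exact absurd (N.simple_arc e t ht' s hs' hlt h.symm).1 ht.1.ne'

theorem eq_or_eq_rev (N : EmbeddedNetwork n E) {e e' : E} {s t : ℝ} (hs : s ∈ Ioo (0 : ℝ) 1)
    (ht : t ∈ Ioo (0 : ℝ) 1) (h : N.arc e s = N.arc e' t) : e = e' ∨ e = N.rev e' := by
  by_contra! hne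
  exact disjoint_left.1 (N.disjoint_arc e e' hne.1 hne.2) ⟨s, hs, rfl⟩ ⟨t, ht, h.symm⟩

theorem rev_ne (N : EmbeddedNetwork n E) (e : E) : N.rev e ≠ e := by
  intro h
  have h1 := N.arc_rev e (1 / 4) (by norm_num)
  rw [h] at h1
  have := N.arc_injOn_Ioo e (by norm_num) (by norm_num) h1
  norm_num at this

/-- Involutivity is not part of the structure. The two arcs share an interior point, so the edges
agree up to reversal, and no edge is its own reversal. -/
theorem rev_rev (N : EmbeddedNetwork n E) (e : E) : N.rev (N.rev e) = e := by
  have h1 : N.arc (N.rev (N.rev e)) (1 / 4) = N.arc e (1 / 4) := by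
    rw [N.arc_rev _ _ (by norm_num), N.arc_rev _ _ (by norm_num), sub_sub_cancel]
  rcases N.eq_or_eq_rev (by norm_num) (by norm_num) h1 with h | h
  · exact h
  · exact absurd h (N.rev_ne _)

theorem tgt_rev (N : EmbeddedNetwork n E) (e : E) : N.tgt (N.rev e) = N.src e := by
  rw [tgt, rev_rev]

theorem along_of_mem (N : EmbeddedNetwork n E) (v : N.carrier → ℝ) (e : E) {s : ℝ}
    (hs : s ∈ Icc (0 : ℝ) 1) : N.along v e s = v (N.point e ⟨s, hs⟩) :=
  IccExtend_of_mem _ _ hs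

theorem along_zero (N : EmbeddedNetwork n E) (v : N.carrier → ℝ) (e : E) :
    N.along v e 0 = N.trace v (N.src e) :=
  N.along_of_mem v e (by simp)

theorem along_one (N : EmbeddedNetwork n E) (v : N.carrier → ℝ) (e : E) :
    N.along v e 1 = N.trace v (N.tgt e) := by
  rw [N.along_of_mem v e (by simp), trace]
  exact congrArg v (Subtype.ext (N.coe_tgt e).symm)

theorem exists_point_eq (N : EmbeddedNetwork n E) (x : N.carrier) : ∃ e s, N.point e s = x := by
  obtain ⟨x, hx⟩ := x
  obtain ⟨e, s, hs, rfl⟩ := mem_iUnion.1 hx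
  exact ⟨e, ⟨s, hs⟩, rfl⟩

/-- Functions on the arcs that are compatible with reversal and agree at the vertices glue to a
function on the network. -/
theorem exists_glue (N : EmbeddedNetwork n E) (u : N.vertices → ℝ) (f : E → ℝ → ℝ)
    (h0 : ∀ e, f e 0 = u (N.src e)) (h1 : ∀ e, f e 1 = u (N.tgt e))
    (hrev : ∀ e, ∀ s ∈ Icc (0 : ℝ) 1, f (N.rev e) s = f e (1 - s)) :
    ∃ v : N.carrier → ℝ, (∀ e, EqOn (N.along v e) (f e) (Icc 0 1)) ∧ N.trace v = u := by
  have hvert : ∀ e, ∀ s ∈ Icc (0 : ℝ) 1, s ∉ Ioo (0 : ℝ) 1 →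
      ∃ x : N.vertices, N.arc e s = x ∧ f e s = u x := by
    intro e s hs hs'
    rcases hs.1.eq_or_lt with rfl | hpos
    · exact ⟨N.src e, rfl, h0 e⟩
    rcases hs.2.eq_or_lt with rfl | hlt
    · exact ⟨N.tgt e, (N.coe_tgt e).symm, h1 e⟩
    · exact absurd ⟨hpos, hlt⟩ hs'
  have hint : ∀ e, ∀ s ∈ Ioo (0 : ℝ) 1, N.arc e s ∉ N.vertices := by
    rintro e s hs ⟨e', h | h⟩
    · exact (N.arc_ne_endpoint e e' s hs).1 h
    · exact (N.arc_ne_endpoint e e' s hs).2 h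
  -- The value at a point does not depend on the chosen parametrization: an interior point
  -- determines its edge up to reversal, and at a vertex the value is that of `u`.
  have hcompat : ∀ e e', ∀ s ∈ Icc (0 : ℝ) 1, ∀ t ∈ Icc (0 : ℝ) 1,
      N.arc e s = N.arc e' t → f e s = f e' t := by
    intro e e' s hs t ht h
    by_cases hs' : s ∈ Ioo (0 : ℝ) 1
    · by_cases ht' : t ∈ Ioo (0 : ℝ) 1
      · rcases N.eq_or_eq_rev hs' ht' h with rfl | rfl
        · rw [N.arc_injOn_Ioo e hs' ht' h]
        · rw [N.arc_rev e' s hs] at h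
          rw [hrev e' s hs, N.arc_injOn_Ioo e' ⟨by linarith [hs'.2], by linarith [hs'.1]⟩ ht' h]
      · obtain ⟨x, hx, -⟩ := hvert e' t ht ht'
        exact absurd (h ▸ hx ▸ x.2) (hint e s hs')
    · obtain ⟨x, hx, hfx⟩ := hvert e s hs hs'
      by_cases ht' : t ∈ Ioo (0 : ℝ) 1
      · exact absurd (h ▸ hx ▸ x.2) (hint e' t ht')
      · obtain ⟨y, hy, hfy⟩ := hvert e' t ht ht'
        rw [hfx, hfy, Subtype.ext (hx.symm.trans (h.trans hy))]
  choose pe ps hp using N.exists_point_eq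
  have hv : ∀ e, EqOn (N.along (fun x => f (pe x) (ps x)) e) (f e) (Icc 0 1) := by
    intro e s hs
    rw [N.along_of_mem _ e hs]
    exact hcompat _ _ _ (ps _).2 _ hs (congrArg Subtype.val (hp (N.point e ⟨s, hs⟩)))
  refine ⟨_, hv, funext fun x => ?_⟩
  obtain ⟨e, rfl⟩ := N.exists_src_eq x
  rw [← N.along_zero, hv e (by simp), h0]

theorem edist_le_geodesicDist (N : EmbeddedNetwork n E) (x y : N.carrier) :
    edist x y ≤ N.geodesicDist x y := by
  refine le_sInf ?_
  rintro L ⟨c, -, -, hx, hy, rfl⟩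
  rw [Subtype.edist_eq, ← hx, ← hy]
  exact eVariationOn.edist_le c (by simp) (by simp)

/-- A function whose restrictions to the arcs are continuous is continuous on the network. -/
theorem isContinuous_of_along [Finite E] (N : EmbeddedNetwork n E) {v : N.carrier → ℝ}
    (hv : ∀ e, ContinuousOn (N.along v e) (Icc 0 1)) : N.IsContinuous v := by
  -- The network is the continuous image of finitely many compact intervals in a Hausdorff space, so
  -- continuity along arcs gives Euclidean continuity. Since the geodesic distance dominates the
  -- Euclidean one, geodesic continuity follows.
  have hq : Topology.IsQuotientMap (fun q : Σ _ : E, Icc (0 : ℝ) 1 => N.point q.1 q.2) := by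
    have hc : Continuous (fun q : Σ _ : E, Icc (0 : ℝ) 1 => N.point q.1 q.2) := by
      refine continuous_sigma fun e => Continuous.subtype_mk ?_ _
      exact continuousOn_iff_continuous_domRestrict.1 (N.contDiffOn_arc e).continuousOn
    refine hc.isClosedMap.isQuotientMap hc fun x => ?_
    obtain ⟨e, s, h⟩ := N.exists_point_eq x
    exact ⟨⟨e, s⟩, h⟩
  have hcont : Continuous v := by
    rw [hq.continuous_iff]
    refine continuous_sigma fun e => ?_
    have := continuousOn_iff_continuous_domRestrict.1 (hv e)
    refine this.congr fun s => ?_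
    exact N.along_of_mem v e s.2
  intro x ε hε
  obtain ⟨δ, hδ, h⟩ := Metric.continuous_iff.1 hcont x ε hε
  refine ⟨δ, hδ, fun y hy => ?_⟩
  rw [← Real.dist_eq]
  refine h y ?_
  rw [dist_comm, ← edist_lt_ofReal]
  exact (N.edist_le_geodesicDist x y).trans_lt hy

/-! ### Hamiltonians on networks -/

theorem IsHamiltonian.isArcHamiltonian {N : EmbeddedNetwork n E} {H : E → ℝ → ℝ → ℝ}
    (hH : N.IsHamiltonian H) (e : E) : IsArcHamiltonian (H e) :=
  ⟨hH.continuousOn e, hH.coercive e, hH.quasiconvex e, hH.interior_sublevel e⟩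

/-- Closed arcs enter `a₀` through `arcC`, which dominates `arcA`. -/
theorem IsHamiltonian.arcA_le_a₀ [Finite E] {N : EmbeddedNetwork n E} {H : E → ℝ → ℝ → ℝ}
    (hH : N.IsHamiltonian H) (e : E) : arcA (H e) ≤ N.a₀ H := by
  refine le_trans ?_ (le_ciSup (f := N.arcLevel H) (finite_range _).bddAbove e)
  unfold arcLevel
  split_ifs
  · exact (hH.isArcHamiltonian e).arcA_le_arcC
  · exact le_rfl

theorem IsHamiltonian.isSublevelEnds [Finite E] {N : EmbeddedNetwork n E} {H : E → ℝ → ℝ → ℝ}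
    (hH : N.IsHamiltonian H) {a : ℝ} (ha : N.a₀ H ≤ a) (e : E) :
    IsSublevelEnds (H e) a (fun s => -sigmaUpper (H (N.rev e)) a (1 - s))
      (sigmaUpper (H e) a) :=
  (hH.isArcHamiltonian e).isSublevelEnds (hH.isArcHamiltonian (N.rev e)) (hH.rev e)
    -- If `arcA (H e) = a`, then `arcA (H e) ≤ a₀ ≤ a` forces equality with `a₀`, so the constancy
    -- hypothesis applies.
    ((hH.arcA_le_a₀ e).trans ha) fun h =>
      hH.min_const e (le_antisymm (hH.arcA_le_a₀ e) (ha.trans h.ge))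

theorem integral_sigmaUpper (H : E → ℝ → ℝ → ℝ) (a : ℝ) (e : E) :
    ∫ r in (0 : ℝ)..1, sigmaUpper (H e) a r = sigma H a e :=
  intervalIntegral.integral_congr fun r hr => sigmaUpper_of_mem _ _ (by simpa using hr)

theorem integral_neg_sigmaUpper (H : E → ℝ → ℝ → ℝ) (a : ℝ) (e : E) :
    ∫ r in (0 : ℝ)..1, -sigmaUpper (H e) a (1 - r) = -sigma H a e := by
  simp [← integral_sigmaUpper, intervalIntegral.integral_comp_sub_left]

/-! ### The discrete functional equation -/

/-- The minimum at `x` charges an outgoing edge with the cost of its reversal, so passing to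
reversed edges turns it into one increment bound per edge. -/
theorem isDiscreteSubsolution_iff [Finite E] {N : EmbeddedNetwork n E} {H : E → ℝ → ℝ → ℝ}
    {a : ℝ} {u : N.vertices → ℝ} : N.IsDiscreteSubsolution H a u ↔
      ∀ e, u (N.tgt e) - u (N.src e) ≤ sigma H a e := by
  constructor
  · intro h e
    have := (h (N.tgt e)).trans ((N.isLeast_starMin H a u (N.tgt e)).2 ⟨N.rev e, rfl, rfl⟩)
    simp only [tgt_rev, rev_rev] at this
    linarith
  · intro h x
    obtain ⟨e, rfl, he⟩ := (N.isLeast_starMin H a u x).1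
    rw [← he]
    have := h (N.rev e)
    rw [tgt_rev] at this
    change u (N.src e) - u (N.tgt e) ≤ _ at this
    simp only
    linarith

/-- Attainment of the minimum is expressed on an edge ending at `x`, the form in which the state
constraint at `1` supplies it. -/
theorem isDiscreteSolution_iff [Finite E] {N : EmbeddedNetwork n E} {H : E → ℝ → ℝ → ℝ}
    {a : ℝ} {u : N.vertices → ℝ} : N.IsDiscreteSolution H a u ↔
      N.IsDiscreteSubsolution H a u ∧
        ∀ x, ∃ e, N.tgt e = x ∧ u (N.tgt e) = u (N.src e) + sigma H a e := by
  constructor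
  · refine fun h => ⟨fun x => (h x).le, fun x => ?_⟩
    obtain ⟨e, rfl, he⟩ := (N.isLeast_starMin H a u x).1
    refine ⟨N.rev e, N.tgt_rev e, ?_⟩
    rw [tgt_rev, h (N.src e), ← he]
    rfl
  · refine fun h x => le_antisymm (h.1 x) ?_
    obtain ⟨e, rfl, he⟩ := h.2 x
    have := (N.isLeast_starMin H a u (N.tgt e)).2 ⟨N.rev e, rfl, rfl⟩
    simp only [tgt_rev, rev_rev] at this
    linarith

theorem isDiscreteSubsolution_trace [Finite E] {N : EmbeddedNetwork n E} {H : E → ℝ → ℝ → ℝ}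
    (hH : N.IsHamiltonian H) {a : ℝ} (ha : N.a₀ H ≤ a) {v : N.carrier → ℝ}
    (hv : ∀ e, IsArcSubsolution (H e) a (N.along v e)) :
    N.IsDiscreteSubsolution H a (N.trace v) := by
  refine isDiscreteSubsolution_iff.2 fun e => ?_
  have := (hH.isSublevelEnds ha e).sub_le_integral (hv e) le_rfl zero_le_one le_rfl
  rwa [along_one, along_zero, integral_sigmaUpper] at this

/-- The maximal extension along the arcs of a discrete subsolution. -/
theorem exists_extension [Finite E] {N : EmbeddedNetwork n E} {H : E → ℝ → ℝ → ℝ}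
    (hH : N.IsHamiltonian H) {a : ℝ} (ha : N.a₀ H ≤ a) {u : N.vertices → ℝ}
    (hu : N.IsDiscreteSubsolution H a u) :
    ∃ v : N.carrier → ℝ, N.trace v = u ∧ N.IsContinuous v ∧
      (∀ e, IsArcSolution (H e) a (N.along v e)) ∧
      ∀ e, u (N.tgt e) = u (N.src e) + sigma H a e →
        StateConstraint (H e) a (N.along v e) 1 := by
  have hsub := isDiscreteSubsolution_iff.1 hu
  have hE := hH.isSublevelEnds ha
  obtain ⟨v, hv, hvu⟩ := N.exists_glue u
    (fun e => arcExtension (fun s => -sigmaUpper (H (N.rev e)) a (1 - s)) (sigmaUpper (H e) a)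
      (u (N.src e)) (u (N.tgt e)))
    (fun e => IsSublevelEnds.arcExtension_zero (by
      have := hsub (N.rev e)
      rw [tgt_rev] at this
      change u (N.src e) - u (N.tgt e) ≤ _ at this
      rw [integral_neg_sigmaUpper]
      linarith))
    (fun e => IsSublevelEnds.arcExtension_one (by
      rw [integral_sigmaUpper]
      exact hsub e))
    (fun e s _ => by
      rw [arcExtension_reflect, arcExtension_reflect, tgt_rev, rev_rev, min_comm, sub_sub_cancel]
      rfl)
  have hsol : ∀ e, IsArcSolution (H e) a (N.along v e) :=
    fun e => (hE e).isArcSolution_arcExtension.congr (hv e)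
  refine ⟨v, hvu, N.isContinuous_of_along fun e => (hsol e).1.1, hsol, fun e he => ?_⟩
  exact (hE e).stateConstraint_arcExtension (by rw [integral_sigmaUpper, he]) (hv e)

/-- Solutions on the network with the same trace on the vertices coincide. -/
theorem eq_of_trace_eq [Finite E] {N : EmbeddedNetwork n E} {H : E → ℝ → ℝ → ℝ}
    (hH : N.IsHamiltonian H) {a : ℝ} (ha : N.a₀ H ≤ a) {v v' : N.carrier → ℝ}
    (hv : ∀ e, IsArcSolution (H e) a (N.along v e))
    (hv' : ∀ e, IsArcSolution (H e) a (N.along v' e)) (h : N.trace v = N.trace v') : v = v' := by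
  funext x
  obtain ⟨e, s, rfl⟩ := N.exists_point_eq x
  rw [← N.along_of_mem v e s.2, ← N.along_of_mem v' e s.2,
    (hH.isSublevelEnds ha e).eqOn_arcExtension (hv e) s.2,
    (hH.isSublevelEnds ha e).eqOn_arcExtension (hv' e) s.2]
  simp only [along_zero, along_one, h]

end EmbeddedNetwork

theorem proposition5p4 {n : ℕ} {E : Type*} [Finite E] (N : EmbeddedNetwork n E)
    (H : E → ℝ → ℝ → ℝ) (hH : N.IsHamiltonian H) (a : ℝ) (ha : N.a₀ H ≤ a) :
    (∀ u : N.vertices → ℝ, N.IsDiscreteSolution H a u →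
      ∃! v : N.carrier → ℝ, N.IsSolution H a v ∧ N.trace v = u) ∧
    (∀ v : N.carrier → ℝ, N.IsSolution H a v → N.IsDiscreteSolution H a (N.trace v)) ∧
    (∀ u : N.vertices → ℝ, N.IsDiscreteSubsolution H a u →
      ∃ v : N.carrier → ℝ, N.IsSubsolution H a v ∧ N.trace v = u) ∧
    (∀ v : N.carrier → ℝ, N.IsSubsolution H a v →
      N.IsDiscreteSubsolution H a (N.trace v)) := by
  refine ⟨fun u hu => ?_, fun v hv => ?_, fun u hu => ?_, fun v hv => ?_⟩
  · obtain ⟨hsub, hmin⟩ := EmbeddedNetwork.isDiscreteSolution_iff.1 hu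
    obtain ⟨v, hvu, hc, hsol, hsc⟩ := EmbeddedNetwork.exists_extension hH ha hsub
    refine ⟨v, ⟨⟨hc, hsol, fun x => ?_⟩, hvu⟩, fun v' ⟨hv', hvu'⟩ => ?_⟩
    · obtain ⟨e, hex, he⟩ := hmin x
      exact ⟨e, hex, hsc e he⟩
    · exact EmbeddedNetwork.eq_of_trace_eq hH ha hv'.2.1 hsol (hvu'.trans hvu.symm)
  · refine EmbeddedNetwork.isDiscreteSolution_iff.2
      ⟨EmbeddedNetwork.isDiscreteSubsolution_trace hH ha fun e => (hv.2.1 e).1, fun x => ?_⟩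
    obtain ⟨e, hex, hsc⟩ := hv.2.2 x
    refine ⟨e, hex, ?_⟩
    have := (hH.isSublevelEnds ha e).sub_eq_integral_of_stateConstraint (hv.2.1 e) hsc
    rw [N.along_one, N.along_zero, EmbeddedNetwork.integral_sigmaUpper] at this
    linarith
  · obtain ⟨v, hvu, hc, hsol, -⟩ := EmbeddedNetwork.exists_extension hH ha hu
    exact ⟨v, ⟨hc, fun e => (hsol e).1⟩, hvu⟩
  · exact EmbeddedNetwork.isDiscreteSubsolution_trace hH ha hv.2
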